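/- Let $M$ be a smooth 4-dimensional manifold with a smooth pseudo-Riemannian metric $g_{ab}$ (of any signature) and Levi-Civita connection $\nabla$. Use the conventions $(\nabla_a\nabla_b-\nabla_b\nabla_a)\omega_c=R_{abc}{}^d\omega_d$, $R_{ac}=R_{abc}{}^b$, $L_{ab}=\tfrac12\big(R_{ab}-\tfrac16 R\,g_{ab}\big)$, and $C_{abc}{}^d=R_{abc}{}^d-2L^d{}_{[b}g_{a]c}-2\delta^d{}_{[b}L_{a]c}$ (Weyl tensor). Assume that $C\cdot C:=C_{abcd}C^{abcd}$ vanishes nowhere on $M$, and put $$\Lambda_d=\frac{8\,C_d{}^{amp}\nabla_{[m}L_{p]a}}{C\cdot C}.$$ The $\mathcal C$-connection of $g$ is the connection on the tangent bundle $\mathcal C_aY^c=\nabla_aY^c+\Gamma[\mathcal C,\nabla]^c{}_{ab}Y^b$ with transition tensor $$\Gamma[\mathcal C,\nabla]^c{}_{ab}=g^{cd}g_{ab}\Lambda_d-\delta_b{}^c\Lambda_a-\delta_a{}^c\Lambda_b .$$ Let $\Theta$ be a smooth positive function on $M$ and let $\tilde g_{ab}=\Theta^{-2}g_{ab}$, with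 $\mathcal C$-connection $\tilde{\mathcal C}$. Then: 1. $\mathcal C$ is a Weyl connection: it is a smooth, torsion-free connection, and $\mathcal C_c g_{ab}=\eta_c\,g_{ab}$ for some smooth one-form $\eta$. Its transition tensor from $\nabla$ is the tensor $\Gamma[\mathcal C,\nabla]$ above. 2. $\mathcal C$ is conformally invariant: $\tilde{\mathcal C}_a=\mathcal C_a$. 3. Consequently the curvature and the Ricci tensor of the $\mathcal C$-connection, $(\mathcal C_a\mathcal C_b-\mathcal C_b\mathcal C_a)\omega_c=\mathcal R_{abc}{}^d\omega_d$ and $\mathcal R_{ac}=\mathcal R_{abc}{}^b$, are conformally invariant: $\tilde{\mathcal R}_{abc}{}^d=\mathcal R_{abc}{}^d$ and $\tilde{\mathcal R}_{ab}=\mathcal R_{ab}$. -/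

import Mathlib

open scoped Manifold ContDiff Bundle

noncomputable section

namespace CConn

/-- The model space of 4-dimensional manifolds. -/
abbrev E4 : Type := EuclideanSpace ℝ (Fin 4)

variable {M : Type*} [TopologicalSpace M] [ChartedSpace E4 M]

/-- The coordinate basis `∂₀, …, ∂₃` of the tangent space at `x` (with respect to the preferred
chart at `x`). Components of tensors at `x` refer to this basis; the tensors defined below do not
depend on it. -/
def frame (x : M) : Module.Basis (Fin 4) ℝ (TangentSpace (𝓡 4) x) :=
  (EuclideanSpace.basisFun (Fin 4) ℝ).toBasis

/-- The coordinate vector `∂ₐ` at `x`. -/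
def ptl (x : M) (a : Fin 4) : TangentSpace (𝓡 4) x := frame x a

/-- The component functional `dxᵃ` at `x`. -/
def dx (x : M) (a : Fin 4) : TangentSpace (𝓡 4) x →L[ℝ] ℝ :=
  (EuclideanSpace.proj a : E4 →L[ℝ] ℝ)

section

variable [IsManifold (𝓡 4) ∞ M]

/-- The vector field `Y` is differentiable at `x`. -/
abbrev DiffAt (Y : Π y : M, TangentSpace (𝓡 4) y) (x : M) : Prop :=
  MDifferentiableAt (𝓡 4) ((𝓡 4).prod 𝓘(ℝ, E4))
    (fun y ↦ Bundle.TotalSpace.mk' E4 (E := TangentSpace (𝓡 4)) y (Y y)) x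

/-- The local extension of the tangent vector `v` at `x` to a vector field which is smooth near `x`
and has constant components in the preferred chart at `x`. -/
abbrev extendVec {x : M} (v : TangentSpace (𝓡 4) x) : Π y : M, TangentSpace (𝓡 4) y := FiberBundle.extend E4 v

variable (M) in
/-- A smooth pseudo-Riemannian metric (of any signature) on a 4-dimensional manifold. -/
structure PseudoRiemannianMetric where
  val (x : M) : TangentSpace (𝓡 4) x →L[ℝ] TangentSpace (𝓡 4) x →L[ℝ] ℝ
  symm (x : M) (v w : TangentSpace (𝓡 4) x) : val x v w = val x w v
  nondegenerate (x : M) (v : TangentSpace (𝓡 4) x) (hv : ∀ w, val x v w = 0) : v = 0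
  contMDiff : ContMDiff (𝓡 4) ((𝓡 4).prod 𝓘(ℝ, E4 →L[ℝ] E4 →L[ℝ] ℝ)) ∞
    (fun x ↦ Bundle.TotalSpace.mk' (E4 →L[ℝ] E4 →L[ℝ] ℝ) x (val x))

namespace PseudoRiemannianMetric

variable (g : PseudoRiemannianMetric M)

/-- The metric at `x` as a bilinear form. -/
def bilin (x : M) : LinearMap.BilinForm ℝ (TangentSpace (𝓡 4) x) :=
  (ContinuousLinearMap.coeLM ℝ).comp (g.val x).toLinearMap

theorem bilin_nondegenerate (x : M) : (g.bilin x).Nondegenerate := by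
  refine ⟨fun v hv ↦ g.nondegenerate x v hv, fun v hv ↦ g.nondegenerate x v fun w ↦ ?_⟩
  rw [g.symm]; exact hv w

instance (x : M) : FiniteDimensional ℝ (TangentSpace (𝓡 4) x) := inferInstanceAs (FiniteDimensional ℝ E4)
instance (x : M) : T2Space (TangentSpace (𝓡 4) x) := inferInstanceAs (T2Space E4)

/-- The vector `α^♯` metrically equivalent to the covector `α`: `g(α^♯, v) = α(v)`. -/
def sharp (x : M) : Module.Dual ℝ (TangentSpace (𝓡 4) x) →ₗ[ℝ] TangentSpace (𝓡 4) x :=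
  ((g.bilin x).toDual (g.bilin_nondegenerate x)).symm.toLinearMap

theorem val_sharp (x : M) (α : Module.Dual ℝ (TangentSpace (𝓡 4) x)) (v : TangentSpace (𝓡 4) x) :
    g.val x (g.sharp x α) v = α v :=
  LinearMap.BilinForm.apply_toDual_symm_apply (B := g.bilin x) (hB := g.bilin_nondegenerate x)
    (f := α) v

/-- If `Y`, `Z` are differentiable vector fields at `x` then so is the function `g(Y, Z)`. -/
theorem mdifferentiableAt_val {x : M} {Y Z : Π y : M, TangentSpace (𝓡 4) y}
    (hY : DiffAt Y x) (hZ : DiffAt Z x) :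
    MDifferentiableAt (𝓡 4) 𝓘(ℝ) (fun y ↦ g.val y (Y y) (Z y)) x := by
  have h : MDifferentiableAt (𝓡 4) ((𝓡 4).prod 𝓘(ℝ))
      (fun y ↦ Bundle.TotalSpace.mk' ℝ (E := Bundle.Trivial M ℝ) y (g.val y (Y y) (Z y))) x := by
    apply MDifferentiableAt.clm_bundle_apply₂ (F₁ := E4) (F₂ := E4)
    · exact g.contMDiff.mdifferentiableAt (by simp)
    · exact hY
    · exact hZ
  simp only [mdifferentiableAt_totalSpace] at h
  exact h.2

/-- The right-hand side of the Koszul formula for `2 g(∇_X Y, Z)` at `x`. -/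
def koszul (Y X Z : Π y : M, TangentSpace (𝓡 4) y) (x : M) : ℝ :=
  mvfderiv (𝓡 4) (fun y ↦ g.val y (Y y) (Z y)) x (X x) + mvfderiv (𝓡 4) (fun y ↦ g.val y (X y) (Z y)) x (Y x)
    - mvfderiv (𝓡 4) (fun y ↦ g.val y (X y) (Y y)) x (Z x)
    + g.val x (VectorField.mlieBracket (𝓡 4) X Y x) (Z x)
    - g.val x (VectorField.mlieBracket (𝓡 4) X Z x) (Y x)
    - g.val x (VectorField.mlieBracket (𝓡 4) Y Z x) (X x)

theorem koszul_tensorial₁ {x : M} {Y Z : Π y : M, TangentSpace (𝓡 4) y} (hY : DiffAt Y x)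
    (hZ : DiffAt Z x) : TensorialAt (𝓡 4) E4 (fun X ↦ g.koszul Y X Z x) x where
  smul {f X} hf hX := by
    simp [koszul, mvfderiv_fun_mul hf (g.mdifferentiableAt_val hX hZ),
      mvfderiv_fun_mul hf (g.mdifferentiableAt_val hX hY),
      VectorField.mlieBracket_smul_left hf hX]
    rw [g.symm x (X x) (Y x), g.symm x (X x) (Z x)]
    ring
  add {X X'} hX hX' := by
    simp [koszul, mvfderiv_fun_add (g.mdifferentiableAt_val hX hZ) (g.mdifferentiableAt_val hX' hZ),
      mvfderiv_fun_add (g.mdifferentiableAt_val hX hY) (g.mdifferentiableAt_val hX' hY),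
      VectorField.mlieBracket_add_left hX hX']
    ring

theorem koszul_tensorial₂ {x : M} {Y X : Π y : M, TangentSpace (𝓡 4) y} (hY : DiffAt Y x)
    (hX : DiffAt X x) : TensorialAt (𝓡 4) E4 (fun Z ↦ g.koszul Y X Z x) x where
  smul {f Z} hf hZ := by
    simp [koszul, mvfderiv_fun_mul hf (g.mdifferentiableAt_val hY hZ),
      mvfderiv_fun_mul hf (g.mdifferentiableAt_val hX hZ),
      VectorField.mlieBracket_smul_right hf hZ]
    rw [g.symm x (Z x) (Y x), g.symm x (Z x) (X x)]
    ring
  add {Z Z'} hZ hZ' := by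
    simp [koszul, mvfderiv_fun_add (g.mdifferentiableAt_val hY hZ) (g.mdifferentiableAt_val hY hZ'),
      mvfderiv_fun_add (g.mdifferentiableAt_val hX hZ) (g.mdifferentiableAt_val hX hZ'),
      VectorField.mlieBracket_add_right hZ hZ']
    ring

theorem koszul_add {x : M} {Y Y' X Z : Π y : M, TangentSpace (𝓡 4) y} (hY : DiffAt Y x)
    (hY' : DiffAt Y' x) (hX : DiffAt X x) (hZ : DiffAt Z x) :
    g.koszul (Y + Y') X Z x = g.koszul Y X Z x + g.koszul Y' X Z x := by
  simp [koszul, mvfderiv_fun_add (g.mdifferentiableAt_val hY hZ) (g.mdifferentiableAt_val hY' hZ),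
      mvfderiv_fun_add (g.mdifferentiableAt_val hX hY) (g.mdifferentiableAt_val hX hY'),
      VectorField.mlieBracket_add_right hY hY', VectorField.mlieBracket_add_left hY hY']
  ring

theorem koszul_smul {x : M} {f : M → ℝ} {Y X Z : Π y : M, TangentSpace (𝓡 4) y} (hf : MDifferentiableAt (𝓡 4) 𝓘(ℝ) f x)
    (hY : DiffAt Y x) (hX : DiffAt X x) (hZ : DiffAt Z x) :
    g.koszul (f • Y) X Z x
      = f x * g.koszul Y X Z x + 2 * (mvfderiv (𝓡 4) f x (X x) * g.val x (Y x) (Z x)) := by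
  simp [koszul, mvfderiv_fun_mul hf (g.mdifferentiableAt_val hY hZ),
      mvfderiv_fun_mul hf (g.mdifferentiableAt_val hX hY),
      VectorField.mlieBracket_smul_right hf hY, VectorField.mlieBracket_smul_left hf hY]
  rw [g.symm x (X x) (Y x)]
  ring

/-- The covariant derivative of `Y` at `x`, as a linear map `X ↦ ∇_X Y`, given by the
Koszul formula. -/
def leviCivitaAt (Y : Π y : M, TangentSpace (𝓡 4) y) (x : M) (hY : DiffAt Y x) : TangentSpace (𝓡 4) x →L[ℝ] TangentSpace (𝓡 4) x :=
  LinearMap.toContinuousLinearMap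
    ((g.sharp x).comp ((ContinuousLinearMap.coeLM ℝ).comp
      ((1 / 2 : ℝ) • (TensorialAt.mkHom₂ (fun X Z ↦ g.koszul Y X Z x) x
        (fun _ hZ ↦ g.koszul_tensorial₁ hY hZ)
        (fun _ hX ↦ g.koszul_tensorial₂ hY hX))).toLinearMap))

theorem val_leviCivitaAt {x : M} {X Y Z : Π y : M, TangentSpace (𝓡 4) y} (hX : DiffAt X x)
    (hY : DiffAt Y x) (hZ : DiffAt Z x) :
    2 * g.val x (g.leviCivitaAt Y x hY (X x)) (Z x) = g.koszul Y X Z x := by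
  have := TensorialAt.mkHom₂_apply (Φ := fun X Z ↦ g.koszul Y X Z x)
        (fun _ hZ ↦ g.koszul_tensorial₁ hY hZ)
        (fun _ hX ↦ g.koszul_tensorial₂ hY hX) hX hZ
  rw [← this]
  simp [leviCivitaAt, val_sharp]

theorem ext_val {x : M} {v w : TangentSpace (𝓡 4) x} (h : ∀ z : TangentSpace (𝓡 4) x, g.val x v z = g.val x w z) : v = w :=
  sub_eq_zero.1 (g.nondegenerate x _ fun z ↦ by simp [h z])

open Classical in
/-- The Levi-Civita connection of `g`. (A vector field is only differentiated at the points where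
it is differentiable; elsewhere the value is set to `0`.) -/
def leviCivita : CovariantDerivative (𝓡 4) E4 (TangentSpace (𝓡 4) : M → Type) where
  toFun Y x := if hY : DiffAt Y x then g.leviCivitaAt Y x hY else 0
  isCovariantDerivativeOnUniv :=
    { add := by
        intro Y Y' x hY hY' _
        have hYY' : DiffAt (Y + Y') x := mdifferentiableAt_add_section hY hY'
        simp only [hY, hY', hYY', dif_pos]
        ext1 v
        refine g.ext_val fun z ↦ ?_
        have hv := FiberBundle.mdifferentiableAt_extend (𝓡 4) E4 v
        have hz := FiberBundle.mdifferentiableAt_extend (𝓡 4) E4 z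
        have h := g.val_leviCivitaAt hv hYY' hz
        rw [g.koszul_add hY hY' hv hz, ← g.val_leviCivitaAt hv hY hz,
          ← g.val_leviCivitaAt hv hY' hz] at h
        simp at h ⊢
        linarith
      leibniz := by
        intro Y f x hY hf _
        have hfY : DiffAt (f • Y) x := hf.smul_section hY
        simp only [hY, hfY, dif_pos]
        ext1 v
        refine g.ext_val fun z ↦ ?_
        have hv := FiberBundle.mdifferentiableAt_extend (𝓡 4) E4 v
        have hz := FiberBundle.mdifferentiableAt_extend (𝓡 4) E4 z
        have h := g.val_leviCivitaAt hv hfY hz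
        rw [g.koszul_smul hf hY hv hz, ← g.val_leviCivitaAt hv hY hz] at h
        simp at h ⊢
        linarith }

/-- The Koszul formula. -/
theorem val_leviCivita {x : M} {X Y Z : Π y : M, TangentSpace (𝓡 4) y} (hX : DiffAt X x)
    (hY : DiffAt Y x) (hZ : DiffAt Z x) :
    2 * g.val x (g.leviCivita Y x (X x)) (Z x) = g.koszul Y X Z x := by
  simp [leviCivita, hY, ← g.val_leviCivitaAt hX hY hZ]

theorem leviCivita_torsion : g.leviCivita.torsion = 0 := by
  rw [CovariantDerivative.torsion_eq_zero_iff]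
  intro X Y x hX hY
  refine g.ext_val fun z ↦ ?_
  have hz := FiberBundle.mdifferentiableAt_extend (𝓡 4) E4 z
  have h₁ := g.val_leviCivita hX hY hz
  have h₂ := g.val_leviCivita hY hX hz
  have h₃ := VectorField.mlieBracket_swap_apply (I := 𝓡 4) (V := X) (W := Y) (x := x)
  have h₄ : (fun y ↦ g.val y (X y) (Y y)) = fun y ↦ g.val y (Y y) (X y) :=
    funext fun y ↦ g.symm y _ _
  simp [koszul, h₃, h₄] at h₁ h₂ ⊢
  linarith

theorem leviCivita_metric {x : M} {X Y Z : Π y : M, TangentSpace (𝓡 4) y} (hX : DiffAt X x)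
    (hY : DiffAt Y x) (hZ : DiffAt Z x) :
    mvfderiv (𝓡 4) (fun y ↦ g.val y (Y y) (Z y)) x (X x)
      = g.val x (g.leviCivita Y x (X x)) (Z x) + g.val x (Y x) (g.leviCivita Z x (X x)) := by
  have h₁ := g.val_leviCivita hX hY hZ
  have h₂ := g.val_leviCivita hX hZ hY
  have h₃ := VectorField.mlieBracket_swap_apply (I := 𝓡 4) (V := Z) (W := Y) (x := x)
  have h₄ : (fun y ↦ g.val y (Z y) (Y y)) = fun y ↦ g.val y (Y y) (Z y) :=
    funext fun y ↦ g.symm y _ _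
  rw [g.symm x (Y x)]
  simp [koszul, h₃, h₄] at h₁ h₂ ⊢
  linarith

end PseudoRiemannianMetric

/-- The Riemann tensor of a connection `D` on the tangent bundle: the vector
`R_{abc}^d u^a v^b w^c`, where `(D_a D_b - D_b D_a) α_c = R_{abc}^d α_d` on one-forms
(`D` torsion free). On vector fields this is
`R(u, v) w = -(D_u D_v w - D_v D_u w - D_{[u, v]} w)`. -/
def riemann (D : CovariantDerivative (𝓡 4) E4 (TangentSpace (𝓡 4) : M → Type)) (x : M)
    (u v w : TangentSpace (𝓡 4) x) : TangentSpace (𝓡 4) x :=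
  -(D (fun y ↦ D (extendVec w) y (extendVec v y)) x u
    - D (fun y ↦ D (extendVec w) y (extendVec u y)) x v
    - D (extendVec w) x (VectorField.mlieBracket (𝓡 4) (extendVec u) (extendVec v) x))

/-- The Ricci tensor `R_{ac} = R_{abc}^b` of a connection on the tangent bundle. -/
def ricci (D : CovariantDerivative (𝓡 4) E4 (TangentSpace (𝓡 4) : M → Type)) (x : M)
    (u w : TangentSpace (𝓡 4) x) : ℝ :=
  ∑ b, dx x b (riemann D x u (ptl x b) w)

namespace PseudoRiemannianMetric

variable (g : PseudoRiemannianMetric M)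

/-- The vector `g^{ab} ∂_b`: inserting `up x a` into a slot of a covariant tensor raises the
corresponding index. -/
def up (x : M) (a : Fin 4) : TangentSpace (𝓡 4) x := g.sharp x (dx x a).toLinearMap

/-- The scalar curvature `R = g^{ab} R_{ab}`. -/
def scalarCurv (x : M) : ℝ := ∑ a, ricci g.leviCivita x (ptl x a) (g.up x a)

/-- The Schouten tensor `L_{ab} = (R_{ab} - R g_{ab} / 6) / 2`. -/
def schouten (x : M) (u v : TangentSpace (𝓡 4) x) : ℝ :=
  1 / 2 * (ricci g.leviCivita x u v - 1 / 6 * g.scalarCurv x * g.val x u v)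

/-- The Weyl tensor `C_{abcd}`, the covariant form of
`C_{abc}^d = R_{abc}^d - 2 L^d_{[b} g_{a]c} - 2 δ^d_{[b} L_{a]c}`. -/
def weyl (x : M) (u v w z : TangentSpace (𝓡 4) x) : ℝ :=
  g.val x (riemann g.leviCivita x u v w) z
    - (g.schouten x z v * g.val x u w - g.schouten x z u * g.val x v w)
    - (g.val x v z * g.schouten x u w - g.val x u z * g.schouten x v w)

/-- The scalar `C · C = C_{abcd} C^{abcd}`. -/
def weylSq (x : M) : ℝ :=
  ∑ a, ∑ b, ∑ c, ∑ d, g.weyl x (ptl x a) (ptl x b) (ptl x c) (ptl x d)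
    * g.weyl x (g.up x a) (g.up x b) (g.up x c) (g.up x d)

/-- The covariant derivative `∇_m L_{pa}` of the Schouten tensor. -/
def covSchouten (x : M) (m p a : TangentSpace (𝓡 4) x) : ℝ :=
  mvfderiv (𝓡 4) (fun y ↦ g.schouten y (extendVec p y) (extendVec a y)) x m
    - g.schouten x (g.leviCivita (extendVec p) x m) a
    - g.schouten x p (g.leviCivita (extendVec a) x m)

/-- The one-form `Λ_d = 8 C_d^{amp} ∇_{[m} L_{p]a} / (C · C)`. -/
def Lam (x : M) : TangentSpace (𝓡 4) x →L[ℝ] ℝ :=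
  ∑ d, (8 * (∑ a, ∑ m, ∑ p, g.weyl x (ptl x d) (g.up x a) (g.up x m) (g.up x p)
      * (1 / 2 * (g.covSchouten x (ptl x m) (ptl x p) (ptl x a)
        - g.covSchouten x (ptl x p) (ptl x m) (ptl x a)))) / g.weylSq x) • dx x d

/-- The transition tensor
`Γ[𝓒, ∇]^c_{ab} X^a Y^b = (g^{cd} g_{ab} Λ_d - δ_b^c Λ_a - δ_a^c Λ_b) X^a Y^b`,
as a linear map in `X`. -/
def transition (x : M) (Y : TangentSpace (𝓡 4) x) :
    TangentSpace (𝓡 4) x →L[ℝ] TangentSpace (𝓡 4) x :=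
  (g.val x Y).smulRight (g.sharp x (g.Lam x).toLinearMap) - (g.Lam x).smulRight Y
    - g.Lam x Y • ContinuousLinearMap.id ℝ (TangentSpace (𝓡 4) x)

open Classical in
/-- The `𝓒`-connection `𝓒_a Y^c = ∇_a Y^c + Γ[𝓒, ∇]^c_{ab} Y^b`. (As for the Levi-Civita
connection, the value is set to `0` at the points where `Y` is not differentiable.) -/
def cConnection : CovariantDerivative (𝓡 4) E4 (TangentSpace (𝓡 4) : M → Type) where
  toFun Y x := if DiffAt Y x then g.leviCivita Y x + g.transition x (Y x) else 0
  isCovariantDerivativeOnUniv :=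
    { add := by
        intro Y Y' x hY hY' _
        have hYY' : DiffAt (Y + Y') x := mdifferentiableAt_add_section hY hY'
        simp only [hY, hY', hYY', if_true]
        rw [g.leviCivita.isCovariantDerivativeOn.add hY hY' (Set.mem_univ x)]
        ext1 v
        simp [transition]
        module
      leibniz := by
        intro Y f x hY hf _
        have hfY : DiffAt (f • Y) x := hf.smul_section hY
        simp only [hY, hfY, if_true]
        rw [g.leviCivita.isCovariantDerivativeOn.leibniz hY hf (Set.mem_univ x)]
        ext1 v
        simp [transition]
        module }

/-- `D` is a Weyl connection of (the conformal class of) `g`: a smooth torsion-free connection such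
that `D_c g_{ab} = η_c g_{ab}` for some smooth one-form `η`. -/
structure IsWeylConnection
    (D : CovariantDerivative (𝓡 4) E4 (TangentSpace (𝓡 4) : M → Type)) : Prop where
  smooth : CovariantDerivative.ContMDiffCovariantDerivative D ∞
  torsion_free : D.torsion = 0
  preserves : ∃ η : Π x : M, TangentSpace (𝓡 4) x →L[ℝ] ℝ,
    ContMDiff (𝓡 4) ((𝓡 4).prod 𝓘(ℝ, E4 →L[ℝ] ℝ)) ∞
      (fun x ↦ Bundle.TotalSpace.mk' (E4 →L[ℝ] ℝ) x (η x)) ∧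
    ∀ (x : M) (X : TangentSpace (𝓡 4) x) (Y Z : Π y : M, TangentSpace (𝓡 4) y),
      DiffAt Y x → DiffAt Z x →
      mvfderiv (𝓡 4) (fun y ↦ g.val y (Y y) (Z y)) x X
          - g.val x (D Y x X) (Z x) - g.val x (Y x) (D Z x X)
        = η x X * g.val x (Y x) (Z x)

end PseudoRiemannianMetric
end
end CConn
end

open scoped Manifold ContDiff Bundle

noncomputable section

namespace CConn

open VectorField

set_option linter.unusedSectionVars false

variable {M : Type*} [TopologicalSpace M] [ChartedSpace E4 M] [IsManifold (𝓡 4) ∞ M]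

/-! Write `g' = e^{2υ} g` with `υ = -log Θ`, and let `N` be the `g`-gradient of `υ`. Conformal
invariance of the connection comes down to one law, `Λ' = Λ + dυ` (`Lam_conformal`). Indeed `∇'_X Y
= ∇_X Y + dυ(X) Y + dυ(Y) X - g(X, Y) N` (`leviCivita_conformal`), and replacing `Λ` by `Λ + dυ`
changes the transition tensor by exactly the opposite amount; the term `g(X, Y) Λ^♯` is itself
insensitive to rescaling `g` with `Λ` fixed.

To find `Λ'`, put `P = -∇dυ + dυ ⊗ dυ - ½ |dυ|² g`. Up to the factor `e^{2υ}`, the lowered Riemann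
tensor changes by the Kulkarni-Nomizu type product of `P` and `g`. Hence the Schouten tensor changes
by `P`, the lowered Weyl tensor is only multiplied by `e^{2υ}`, and `C · C` by `e^{-4υ}`. In the
antisymmetrised derivative of the Schouten tensor, the third derivatives of `υ` combine to the
curvature applied to `N`, which the Schouten terms complete to the Weyl tensor (`cotton_conformal`).
Contracting with the Weyl tensor therefore adds a multiple of `C_d^{amp} C_{eamp} N^e`. In dimension
four this is a pure trace, `¼ (C · C) N_d` (`DualPair.four_mul_weylContr`), so division by `C · C`
leaves a multiple of `dυ`; the 8 in `Λ` compensates this `¼` and the `½` of the antisymmetrisation.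

The four-dimensional identity is pure algebra: in an orthogonal basis the symmetries of the Weyl
tensor leave ten free parameters, and the identity becomes polynomial in them. The Weyl property
holds because the transition tensor is symmetric in its lower indices and changes the derivative of
`g` by `2 Λ ⊗ g`. The curvature statements follow because `riemann` and `ricci` depend on the
connection alone. -/

/-- The vector field `X` is smooth on `U`. -/
abbrev SmoothVF (U : Set M) (X : Π y : M, TangentSpace (𝓡 4) y) : Prop :=
  ContMDiffOn (𝓡 4) ((𝓡 4).prod 𝓘(ℝ, E4)) ∞
    (fun y ↦ Bundle.TotalSpace.mk' E4 (E := TangentSpace (𝓡 4)) y (X y)) U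

/-- The function `f` is smooth on `U`. -/
abbrev SmoothFun (U : Set M) (f : M → ℝ) : Prop := ContMDiffOn (𝓡 4) 𝓘(ℝ) ∞ f U

/-- The derivative of the function `f` along the vector field `X`. -/
abbrev lie (X : Π y : M, TangentSpace (𝓡 4) y) (f : M → ℝ) (y : M) : ℝ :=
  mvfderiv (𝓡 4) f y (X y)

/-! ### Smooth functions and vector fields on open sets. -/

variable {U : Set M} {X Y Z W : Π y : M, TangentSpace (𝓡 4) y} {f h : M → ℝ} {x : M}

theorem SmoothVF.diffAt (hX : SmoothVF U X) (hU : IsOpen U) (hx : x ∈ U) : DiffAt X x :=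
  (hX.contMDiffAt (hU.mem_nhds hx)).mdifferentiableAt (by simp)

theorem SmoothFun.mdiffAt (hf : SmoothFun U f) (hU : IsOpen U) (hx : x ∈ U) :
    MDifferentiableAt (𝓡 4) 𝓘(ℝ) f x :=
  (hf.contMDiffAt (hU.mem_nhds hx)).mdifferentiableAt (by simp)

theorem SmoothVF.mono {V : Set M} (hX : SmoothVF U X) (h : V ⊆ U) : SmoothVF V X :=
  ContMDiffOn.mono hX h

theorem SmoothFun.mono {V : Set M} (hf : SmoothFun U f) (h : V ⊆ U) : SmoothFun V f :=
  ContMDiffOn.mono hf h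

theorem isManifold_minSmoothness_two : IsManifold (𝓡 4) (minSmoothness ℝ 2) M :=
  IsManifold.of_le (n := ∞) (by simpa using! (ENat.LEInfty.out : (2 : ℕ∞ω) ≤ ∞))

theorem isManifold_minSmoothness_three : IsManifold (𝓡 4) (minSmoothness ℝ 3) M :=
  IsManifold.of_le (n := ∞) (by simpa using! (ENat.LEInfty.out : (3 : ℕ∞ω) ≤ ∞))

theorem isManifold_infty_add_one : IsManifold (𝓡 4) (((⊤ : ℕ∞) : ℕ∞ω) + 1) M :=
  IsManifold.of_le (n := ∞) (by simp)

attribute [local instance] isManifold_minSmoothness_two isManifold_minSmoothness_three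
  isManifold_infty_add_one

theorem SmoothFun.lie (hU : IsOpen U) (hf : SmoothFun U f) (hX : SmoothVF U X) :
    SmoothFun U (lie X f) := by
  intro y hy
  have hfy := hf.contMDiffAt (hU.mem_nhds hy)
  have hXy := hX.contMDiffAt (hU.mem_nhds hy)
  have h := ContMDiffAt.clm_apply_of_inCoordinates (m₀ := y) (b₁ := id) (b₂ := f)
    (E₁ := TangentSpace (𝓡 4)) (E₂ := TangentSpace 𝓘(ℝ)) (F₁ := E4) (F₂ := ℝ)
    (ϕ := fun m ↦ mfderiv (𝓡 4) 𝓘(ℝ) f m) (v := X)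
    (hfy.mfderiv_const (m := ∞) (by simp)) hXy hfy
  have h2 := (Bundle.contMDiffAt_totalSpace.1 h).2
  refine ContMDiffAt.contMDiffWithinAt ?_
  convert h2 using 2
  simp [CConn.lie, mvfderiv]
  rfl

theorem SmoothVF.bracket (hU : IsOpen U) (hX : SmoothVF U X) (hY : SmoothVF U Y) :
    SmoothVF U (mlieBracket (𝓡 4) X Y) := fun y hy ↦
  (ContMDiffAt.mlieBracket_vectorField (m := ⊤) (n := ⊤) (hX.contMDiffAt (hU.mem_nhds hy))
    (hY.contMDiffAt (hU.mem_nhds hy)) (by simp)).contMDiffWithinAt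

theorem SmoothVF.add (hX : SmoothVF U X) (hY : SmoothVF U Y) : SmoothVF U (X + Y) :=
  ContMDiffOn.add_section hX hY

theorem SmoothVF.sub (hX : SmoothVF U X) (hY : SmoothVF U Y) : SmoothVF U (X - Y) :=
  ContMDiffOn.sub_section hX hY

theorem SmoothVF.smul (hf : SmoothFun U f) (hX : SmoothVF U X) : SmoothVF U (f • X) :=
  ContMDiffOn.smul_section hf hX

theorem SmoothVF.sum {ι : Type*} {s : Finset ι} {V : ι → Π y : M, TangentSpace (𝓡 4) y}
    (hV : ∀ i ∈ s, SmoothVF U (V i)) : SmoothVF U (fun y ↦ ∑ i ∈ s, V i y) :=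
  ContMDiffOn.sum_section hV

/-- The domain of the preferred chart at `x`. -/
def dom (x : M) : Set M := (trivializationAt E4 (TangentSpace (𝓡 4) : M → Type) x).baseSet

theorem isOpen_dom (x : M) : IsOpen (dom x) :=
  (trivializationAt E4 (TangentSpace (𝓡 4) : M → Type) x).open_baseSet

theorem mem_dom (x : M) : x ∈ dom x := FiberBundle.mem_baseSet_trivializationAt' x

theorem smoothVF_extendVec {x : M} (v : TangentSpace (𝓡 4) x) : SmoothVF (dom x) (extendVec v) := by
  set t := trivializationAt E4 (TangentSpace (𝓡 4) : M → Type) x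
  suffices ContMDiffOn (𝓡 4) 𝓘(ℝ, E4) ∞ (fun y ↦ (t ⟨y, extendVec v y⟩).2) t.baseSet by
    intro y hy
    exact (t.contMDiffWithinAt_section _ hy).2 (this y hy)
  have : ContMDiffOn (𝓡 4) 𝓘(ℝ, E4) ∞ (fun _ : M ↦ (t ⟨x, v⟩).2) t.baseSet := contMDiffOn_const
  exact this.congr fun y hy ↦ by simp only [FiberBundle.extend, t, hy, Bundle.Trivialization.apply_mk_symm]

@[simp] theorem extendVec_self {x : M} (v : TangentSpace (𝓡 4) x) : extendVec v x = v := by simp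

/-- The Lie bracket is the commutator of derivations. -/
theorem lie_comm (hU : IsOpen U) (hX : SmoothVF U X) (hY : SmoothVF U Y) (hf : SmoothFun U f)
    (hx : x ∈ U) : lie X (lie Y f) x - lie Y (lie X f) x = lie (mlieBracket (𝓡 4) X Y) f x := by
  -- The Jacobi identity for `X`, `Y`, `f • Z` minus `f` times the one for `X`, `Y`, `Z` leaves `(X
  -- Y f - Y X f - [X, Y] f) • Z`. A field `Z` with nonzero value `v` at `x` lets the coefficient be
  -- read off.
  obtain ⟨v, hv⟩ : ∃ v : TangentSpace (𝓡 4) x, v ≠ 0 := exists_ne (α := E4) 0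
  set V := U ∩ dom x
  have hV : IsOpen V := hU.inter (isOpen_dom x)
  have hxV : x ∈ V := ⟨hx, mem_dom x⟩
  replace hX := hX.mono (V := V) Set.inter_subset_left
  replace hY := hY.mono (V := V) Set.inter_subset_left
  replace hf := hf.mono (V := V) Set.inter_subset_left
  set Z : Π y : M, TangentSpace (𝓡 4) y := extendVec v with hZdef
  have hZ : SmoothVF V Z := (smoothVF_extendVec v).mono Set.inter_subset_right
  have hZx : Z x = v := extendVec_self v
  have key : ∀ {X' : Π y : M, TangentSpace (𝓡 4) y}, mlieBracket (𝓡 4) X' (f • Z) =ᶠ[nhds x]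
      (lie X' f) • Z + f • mlieBracket (𝓡 4) X' Z := by
    intro X'
    filter_upwards [hV.mem_nhds hxV] with y hy
    rw [mlieBracket_smul_right (hf.mdiffAt hV hy) (hZ.diffAt hV hy)]
    rfl
  have at_ : ∀ {A : Π y : M, TangentSpace (𝓡 4) y}, SmoothVF V A →
      ContMDiffAt (𝓡 4) ((𝓡 4).prod 𝓘(ℝ, E4)) (minSmoothness ℝ 2)
        (fun y ↦ Bundle.TotalSpace.mk' E4 (E := TangentSpace (𝓡 4)) y (A y)) x := by
    intro A hA
    exact (hA.contMDiffAt (hV.mem_nhds hxV)).of_le (by simpa using! (ENat.LEInfty.out : (2 : ℕ∞ω) ≤ ∞))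
  have J1 := leibniz_identity_mlieBracket_apply (at_ hX) (at_ hY) (at_ (hZ.smul hf))
  have J2 := leibniz_identity_mlieBracket_apply (at_ hX) (at_ hY) (at_ hZ)
  have expand : ∀ {A B : Π y : M, TangentSpace (𝓡 4) y}, SmoothVF V A → SmoothVF V B →
      mlieBracket (𝓡 4) A (mlieBracket (𝓡 4) B (f • Z)) x
        = lie A (lie B f) x • Z x + lie B f x • mlieBracket (𝓡 4) A Z x
          + (lie A f x • mlieBracket (𝓡 4) B Z x
            + f x • mlieBracket (𝓡 4) A (mlieBracket (𝓡 4) B Z) x) := by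
    intro A B hA hB
    rw [Filter.EventuallyEq.mlieBracket_vectorField_eq (Filter.EventuallyEq.refl _ A) key,
      mlieBracket_add_right ((hZ.smul (hf.lie hV hB)).diffAt hV hxV)
        (((hB.bracket hV hZ).smul hf).diffAt hV hxV),
      mlieBracket_smul_right ((hf.lie hV hB).mdiffAt hV hxV) (hZ.diffAt hV hxV),
      mlieBracket_smul_right (hf.mdiffAt hV hxV) ((hB.bracket hV hZ).diffAt hV hxV)]
  rw [expand hX hY, expand hY hX, mlieBracket_smul_right (hf.mdiffAt hV hxV) (hZ.diffAt hV hxV),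
    J2, hZx] at J1
  have : (lie X (lie Y f) x - lie Y (lie X f) x - lie (mlieBracket (𝓡 4) X Y) f x) • v = 0 := by
    simp only [sub_smul]
    rw [← sub_eq_zero] at J1
    simp only [CConn.lie] at J1 ⊢
    rw [← J1]
    module
  have := (smul_eq_zero.1 this).resolve_right hv
  linarith

/-- A section of a bundle of homomorphisms from the tangent bundle is smooth if its values on
constant extensions of tangent vectors are. -/
theorem contMDiffAt_hom_of_extendVec {F₂ : Type*} [NormedAddCommGroup F₂] [NormedSpace ℝ F₂]
    {E₂ : M → Type*} [∀ y, AddCommGroup (E₂ y)] [∀ y, Module ℝ (E₂ y)]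
    [∀ y, TopologicalSpace (E₂ y)] [∀ y, IsTopologicalAddGroup (E₂ y)]
    [∀ y, ContinuousSMul ℝ (E₂ y)]
    [TopologicalSpace (Bundle.TotalSpace F₂ E₂)] [FiberBundle F₂ E₂] [VectorBundle ℝ F₂ E₂]
    {φ : Π y : M, TangentSpace (𝓡 4) y →L[ℝ] E₂ y}
    (hφ : ∀ v : TangentSpace (𝓡 4) x, ContMDiffAt (𝓡 4) ((𝓡 4).prod 𝓘(ℝ, F₂)) ∞
      (fun y ↦ Bundle.TotalSpace.mk' F₂ y (φ y (extendVec v y))) x) :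
    ContMDiffAt (𝓡 4) ((𝓡 4).prod 𝓘(ℝ, E4 →L[ℝ] F₂)) ∞
      (fun y ↦ Bundle.TotalSpace.mk' (E4 →L[ℝ] F₂)
        (E := fun y : M ↦ TangentSpace (𝓡 4) y →L[ℝ] E₂ y) y (φ y)) x := by
  rw [contMDiffAt_hom_bundle]
  refine ⟨contMDiffAt_id, ?_⟩
  set t := trivializationAt E4 (TangentSpace (𝓡 4) : M → Type) x
  set t₂ := trivializationAt F₂ E₂ x
  have hx : x ∈ t.baseSet := mem_dom x
  -- The extension of `t.symm x v` has constant coordinate `v` near `x`, so the hypothesis says that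
  -- the coordinate operator applied to `v` depends smoothly on the point.
  have hcoord : ∀ v : E4, ContMDiffAt (𝓡 4) 𝓘(ℝ, F₂) ∞ (fun y ↦
      ContinuousLinearMap.inCoordinates E4 (TangentSpace (𝓡 4) : M → Type) F₂ E₂ x y x y (φ y) v)
      x := by
    intro v
    refine ((Bundle.contMDiffAt_section _).1 (hφ (t.symm x v))).congr_of_eventuallyEq ?_
    filter_upwards [t.open_baseSet.mem_nhds hx,
      t₂.open_baseSet.mem_nhds (FiberBundle.mem_baseSet_trivializationAt' x)] with y hy hy₂
    rw [ContinuousLinearMap.inCoordinates_eq hy hy₂]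
    have e : (t ⟨x, t.symm x v⟩).2 = v := by rw [t.apply_mk_symm hx]
    simp only [FiberBundle.extend]
    change _ = (t₂ ⟨y, φ y (t.symm y (t ⟨x, t.symm x v⟩).2)⟩).2
    rw [e]
    simp [t, t₂]
  -- An operator on `ℝ⁴` is the sum of its columns paired with the coordinate functionals, so smooth
  -- columns give a smooth operator.
  have hsum : (fun y ↦ ContinuousLinearMap.inCoordinates E4 (TangentSpace (𝓡 4) : M → Type) F₂ E₂
      x y x y (φ y)) = fun y ↦ ∑ i : Fin 4,
        (ContinuousLinearMap.smulRightL ℝ E4 F₂ (EuclideanSpace.proj i))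
          (ContinuousLinearMap.inCoordinates E4 (TangentSpace (𝓡 4) : M → Type) F₂ E₂ x y x y (φ y)
            (EuclideanSpace.single i 1)) := by
    funext y
    ext v
    simp only [ContinuousLinearMap.smulRightL_apply_apply, _root_.sum_apply,
      ContinuousLinearMap.smulRight_apply]
    conv_lhs => rw [← (EuclideanSpace.basisFun (Fin 4) ℝ).sum_repr v]
    simp
  simp only
  rw [hsum]
  exact contMDiffAt_finsetSum fun i _ ↦
    (ContinuousLinearMap.contMDiff _).contMDiffAt.comp x (hcoord _)

theorem SmoothFun.finsetSum {ι : Type*} {s : Finset ι} {F : ι → M → ℝ}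
    (hF : ∀ i ∈ s, SmoothFun U (F i)) : SmoothFun U (fun y ↦ ∑ i ∈ s, F i y) :=
  contMDiffOn_finsetSum hF

theorem SmoothFun.finsetProd {ι : Type*} {s : Finset ι} {F : ι → M → ℝ}
    (hF : ∀ i ∈ s, SmoothFun U (F i)) : SmoothFun U (fun y ↦ ∏ i ∈ s, F i y) :=
  contMDiffOn_finsetProd hF

theorem SmoothFun.add (hf : SmoothFun U f) (hh : SmoothFun U h) : SmoothFun U (fun y ↦ f y + h y) :=
  ContMDiffOn.add hf hh

theorem SmoothFun.sub (hf : SmoothFun U f) (hh : SmoothFun U h) : SmoothFun U (fun y ↦ f y - h y) :=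
  ContMDiffOn.sub hf hh

theorem SmoothFun.mul (hf : SmoothFun U f) (hh : SmoothFun U h) : SmoothFun U (fun y ↦ f y * h y) :=
  ContMDiffOn.mul hf hh

theorem SmoothFun.const (c : ℝ) : SmoothFun U (fun _ : M ↦ c) := contMDiffOn_const

theorem SmoothFun.inv (hf : SmoothFun U f) (h0 : ∀ y ∈ U, f y ≠ 0) : SmoothFun U (fun y ↦ (f y)⁻¹) :=
  ContMDiffOn.inv₀ hf h0

theorem SmoothFun.det {n : ℕ} {A : Fin n → Fin n → M → ℝ} (hA : ∀ i j, SmoothFun U (A i j)) :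
    SmoothFun U (fun y ↦ (Matrix.of fun i j ↦ A i j y).det) := by
  simp only [Matrix.det_apply']
  exact .finsetSum fun σ _ ↦ (SmoothFun.const _).mul (.finsetProd fun i _ ↦ hA _ _)

/-- Cramer's rule: an entry of the adjugate is the determinant of the matrix with one row replaced
by a constant unit vector. -/
theorem SmoothFun.matrix_inv {n : ℕ} {A : Fin n → Fin n → M → ℝ}
    (hA : ∀ i j, SmoothFun U (A i j))
    (h0 : ∀ y ∈ U, (Matrix.of fun i j ↦ A i j y).det ≠ 0) (i j : Fin n) :
    SmoothFun U (fun y ↦ (Matrix.of fun i j ↦ A i j y)⁻¹ i j) := by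
  simp only [Matrix.inv_def, Ring.inverse_eq_inv', Matrix.smul_apply, smul_eq_mul,
    Matrix.adjugate_apply]
  refine ((SmoothFun.det hA).inv h0).mul ?_
  refine (SmoothFun.det (A := fun k l y ↦ if k = j then (Pi.single i 1 : Fin n → ℝ) l else A k l y)
    fun k l ↦ ?_).congr fun y _ ↦ ?_
  · by_cases hk : k = j
    · simpa [hk] using SmoothFun.const _
    · simpa [hk] using hA k l
  · congr 1
    ext k l
    simp [Matrix.updateRow_apply]

/-! ### Coordinate frames, dual frames and metric contractions. -/

/-- The coordinate vector fields of the preferred chart at `x`. -/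
abbrev loc (x : M) (i : Fin 4) : Π y : M, TangentSpace (𝓡 4) y := extendVec (ptl x i)

/-- The basis of the tangent space at `y` consisting of coordinate vector fields of the
preferred chart at `x`. -/
def locBasis {x y : M} (hy : y ∈ dom x) : Module.Basis (Fin 4) ℝ (TangentSpace (𝓡 4) y) :=
  (frame x).map (((trivializationAt E4 (TangentSpace (𝓡 4) : M → Type) x).linearEquivAt ℝ x
    (mem_dom x)).trans ((trivializationAt E4 (TangentSpace (𝓡 4) : M → Type) x).linearEquivAt ℝ y
      hy).symm)

theorem locBasis_apply {x y : M} (hy : y ∈ dom x) (i : Fin 4) : locBasis hy i = loc x i y := by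
  simp only [locBasis, Module.Basis.map_apply]
  rfl

theorem smoothVF_loc (x : M) (i : Fin 4) : SmoothVF (dom x) (loc x i) := smoothVF_extendVec _

namespace PseudoRiemannianMetric

variable (g : PseudoRiemannianMetric M)

theorem smoothFun_val (hX : SmoothVF U X) (hY : SmoothVF U Y) :
    SmoothFun U (fun y ↦ g.val y (X y) (Y y)) := by
  intro y hy
  have h := ContMDiffWithinAt.clm_bundle_apply₂ (F₁ := E4) (F₂ := E4) (F₃ := ℝ)
      (E₃ := Bundle.Trivial M ℝ) (b := id) (g.contMDiff y).contMDiffWithinAt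
      (hX y hy) (hY y hy)
  exact (Bundle.contMDiffWithinAt_totalSpace.1 h).2

theorem gram_det_ne_zero {x y : M} (hy : y ∈ dom x) :
    (Matrix.of fun i j ↦ g.val y (loc x i y) (loc x j y)).det ≠ 0 := by
  have h := (LinearMap.BilinForm.nondegenerate_iff_det_ne_zero (locBasis hy)).1
    (g.bilin_nondegenerate y)
  convert h using 2
  ext i j
  simp [locBasis_apply, bilin]

theorem ext_loc {x y : M} (hy : y ∈ dom x) {v w : TangentSpace (𝓡 4) y}
    (h : ∀ i, g.val y v (loc x i y) = g.val y w (loc x i y)) : v = w := by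
  refine g.ext_val fun z ↦ ?_
  have : g.val y v = g.val y w := by
    apply ContinuousLinearMap.coe_injective
    refine (locBasis hy).ext fun i ↦ ?_
    simpa [locBasis_apply] using h i
  rw [this]

/-- A vector field is smooth if its lowered components are. -/
theorem smoothVF_of_val {x : M} {N : Π y : M, TangentSpace (𝓡 4) y} (hU : U ⊆ dom x)
    (hN : ∀ i, SmoothFun U (fun y ↦ g.val y (N y) (loc x i y))) : SmoothVF U N := by
  set G : M → Matrix (Fin 4) (Fin 4) ℝ :=
    fun y ↦ Matrix.of fun i j ↦ g.val y (loc x i y) (loc x j y) with hG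
  have hinv : ∀ i j, SmoothFun U (fun y ↦ (G y)⁻¹ i j) := SmoothFun.matrix_inv
    (fun i j ↦ (g.smoothFun_val (smoothVF_loc x i) (smoothVF_loc x j)).mono hU)
    fun y hy ↦ g.gram_det_ne_zero (hU hy)
  -- Inverting the Gram matrix recovers the components of `N` from its lowered components;
  -- nondegeneracy of the metric then identifies this smooth combination with `N`.
  have hsm : SmoothVF U (fun y ↦ ∑ i, (fun y ↦ ∑ j, (G y)⁻¹ i j * g.val y (N y) (loc x j y)) y
      • loc x i y) :=
    .sum fun i _ ↦ .smul (.finsetSum fun j _ ↦ (hinv i j).mul (hN j)) ((smoothVF_loc x i).mono hU)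
  refine hsm.congr fun y hy ↦ ?_
  congr 1
  refine g.ext_loc (hU hy) fun k ↦ ?_
  have hGG : G y * (G y)⁻¹ = 1 := Matrix.mul_nonsing_inv _ (g.gram_det_ne_zero (hU hy)).isUnit
  have hk : ∀ j, ∑ i, G y k i * (G y)⁻¹ i j = if k = j then 1 else 0 := fun j ↦ by
    rw [← Matrix.mul_apply, hGG, Matrix.one_apply]
  have hsymm : ∀ i, g.val y (loc x i y) (loc x k y) = G y k i := fun i ↦ by
    rw [g.symm]; rfl
  simp only [map_sum, map_smul, _root_.sum_apply, _root_.smul_apply, smul_eq_mul,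
    hsymm, Finset.sum_mul]
  rw [Finset.sum_comm]
  have : ∀ j, ∑ i, (G y)⁻¹ i j * g.val y (N y) (loc x j y) * G y k i
      = g.val y (N y) (loc x j y) * if k = j then 1 else 0 := fun j ↦ by
    rw [← hk j, Finset.mul_sum]
    exact Finset.sum_congr rfl fun i _ ↦ by ring
  simp [this]

/-- `e` and `f` are dual bases with respect to the metric at `x`. -/
def DualPair (x : M) (e f : Fin 4 → TangentSpace (𝓡 4) x) : Prop :=
  ∀ w, ∑ a, g.val x (e a) w • f a = w

variable {g}

theorem DualPair.swap {e f : Fin 4 → TangentSpace (𝓡 4) x} (h : g.DualPair x e f) :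
    g.DualPair x f e := by
  intro w
  refine g.ext_val fun z ↦ ?_
  conv_rhs => rw [← h z]
  simp [g.symm x w, mul_comm]

/-- Contractions with respect to the metric do not depend on the choice of dual bases. -/
theorem DualPair.contract_eq {e f e' f' : Fin 4 → TangentSpace (𝓡 4) x} (h : g.DualPair x e f)
    (h' : g.DualPair x e' f') {B : TangentSpace (𝓡 4) x → TangentSpace (𝓡 4) x → ℝ}
    (hB₁ : ∀ w, IsLinearMap ℝ (fun v ↦ B v w)) (hB₂ : ∀ v, IsLinearMap ℝ (B v)) :
    ∑ a, B (e a) (f a) = ∑ a, B (e' a) (f' a) := by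
  -- Expanding the first slot of the left side in the primed pair and the second slot of the right
  -- side in the unprimed pair yields the same double sum.
  have h1 : ∀ w v : TangentSpace (𝓡 4) x, B v w = ∑ c, g.val x (f' c) v * B (e' c) w := by
    intro w v
    conv_lhs => rw [← h'.swap v]
    change IsLinearMap.mk' _ (hB₁ w) _ = _
    simp
  have h2 : ∀ v w : TangentSpace (𝓡 4) x, B v w = ∑ a, g.val x (e a) w * B v (f a) := by
    intro v w
    conv_lhs => rw [← h w]
    change IsLinearMap.mk' _ (hB₂ v) _ = _
    simp
  simp_rw [fun a ↦ h1 (f a) (e a), fun a ↦ h2 (e' a) (f' a)]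
  rw [Finset.sum_comm]
  simp_rw [g.symm x (f' _)]

variable (g)

theorem val_up (x : M) (a : Fin 4) (v : TangentSpace (𝓡 4) x) : g.val x (g.up x a) v = dx x a v :=
  g.val_sharp x _ v

theorem sum_dx_smul_ptl (x : M) (v : TangentSpace (𝓡 4) x) : ∑ a, dx x a v • ptl x a = v := by
  conv_rhs => rw [← (frame x).sum_repr v]
  rfl

theorem dualPair_up_ptl (x : M) : g.DualPair x (g.up x) (ptl x) := by
  intro w
  simp_rw [val_up]
  exact sum_dx_smul_ptl x w

theorem dualPair_ptl_up (x : M) : g.DualPair x (ptl x) (g.up x) := (g.dualPair_up_ptl x).swap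

/-- The vector fields dual to the coordinate vector fields of the preferred chart at `x`. -/
def coloc (x : M) (i : Fin 4) (y : M) : TangentSpace (𝓡 4) y :=
  open Classical in if hy : y ∈ dom x then g.sharp y ((locBasis hy).coord i) else 0

theorem val_coloc {x y : M} (hy : y ∈ dom x) (i : Fin 4) (v : TangentSpace (𝓡 4) y) :
    g.val y (g.coloc x i y) v = (locBasis hy).coord i v := by
  simp [coloc, hy, val_sharp]

/-- The lowered components are Kronecker deltas, hence constant. Smoothness of contractions is
tested with `loc` and `coloc`, because `ptl` and `up` refer to a possibly different chart at each
point. -/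
theorem smoothVF_coloc (x : M) (i : Fin 4) : SmoothVF (dom x) (g.coloc x i) := by
  refine g.smoothVF_of_val subset_rfl fun j ↦ ?_
  refine (SmoothFun.const (if j = i then 1 else 0)).congr fun y hy ↦ ?_
  rw [g.val_coloc hy, ← locBasis_apply hy]
  simp [Finsupp.single_apply]

theorem dualPair_coloc_loc {x y : M} (hy : y ∈ dom x) :
    g.DualPair y (fun i ↦ g.coloc x i y) (fun i ↦ loc x i y) := by
  intro w
  simp_rw [g.val_coloc hy, ← locBasis_apply hy]
  exact (locBasis hy).sum_repr w

theorem dualPair_loc_coloc {x y : M} (hy : y ∈ dom x) :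
    g.DualPair y (fun i ↦ loc x i y) (fun i ↦ g.coloc x i y) := (g.dualPair_coloc_loc hy).swap

/-! ### The Levi-Civita connection on vector fields. -/

/-- The covariant derivative `∇_X Y` of the Levi-Civita connection. -/
abbrev nabla (X Y : Π y : M, TangentSpace (𝓡 4) y) (y : M) : TangentSpace (𝓡 4) y :=
  g.leviCivita Y y (X y)

theorem smoothFun_koszul (hU : IsOpen U) (hX : SmoothVF U X) (hY : SmoothVF U Y)
    (hZ : SmoothVF U Z) : SmoothFun U (g.koszul Y X Z) :=
  (((((g.smoothFun_val hY hZ).lie hU hX).add ((g.smoothFun_val hX hZ).lie hU hY)).sub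
    ((g.smoothFun_val hX hY).lie hU hZ)).add (g.smoothFun_val (hX.bracket hU hY) hZ)).sub
    (g.smoothFun_val (hX.bracket hU hZ) hY) |>.sub (g.smoothFun_val (hY.bracket hU hZ) hX)

/-- The lowered components of `∇_X Y` in a coordinate frame are Koszul expressions, which are
smooth. -/
theorem smoothVF_nabla (hU : IsOpen U) (hX : SmoothVF U X) (hY : SmoothVF U Y) :
    SmoothVF U (g.nabla X Y) := by
  intro x hx
  have hV : IsOpen (U ∩ dom x) := hU.inter (isOpen_dom x)
  have h : SmoothVF (U ∩ dom x) (g.nabla X Y) := by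
    refine g.smoothVF_of_val Set.inter_subset_right fun i ↦ ?_
    have hX' := hX.mono (V := U ∩ dom x) Set.inter_subset_left
    have hY' := hY.mono (V := U ∩ dom x) Set.inter_subset_left
    have hE := (smoothVF_loc x i).mono (V := U ∩ dom x) Set.inter_subset_right
    refine ((SmoothFun.const (1 / 2)).mul (g.smoothFun_koszul hV hX' hY' hE)).congr fun y hy ↦ ?_
    rw [← g.val_leviCivita (hX'.diffAt hV hy) (hY'.diffAt hV hy) (hE.diffAt hV hy)]
    ring
  exact (h.contMDiffAt (hV.mem_nhds ⟨hx, mem_dom x⟩)).contMDiffWithinAt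

/-- The covariant derivative of a smooth vector field is a smooth section of the endomorphism
bundle. -/
theorem contMDiffAt_leviCivita (hU : IsOpen U) (hY : SmoothVF U Y) (hx : x ∈ U) :
    ContMDiffAt (𝓡 4) ((𝓡 4).prod 𝓘(ℝ, E4 →L[ℝ] E4)) ∞
      (fun y ↦ Bundle.TotalSpace.mk' (E4 →L[ℝ] E4)
        (E := fun z : M ↦ TangentSpace (𝓡 4) z →L[ℝ] TangentSpace (𝓡 4) z) y
        (g.leviCivita Y y)) x := by
  refine contMDiffAt_hom_of_extendVec fun v ↦ ?_
  have hV : IsOpen (U ∩ dom x) := hU.inter (isOpen_dom x)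
  exact (g.smoothVF_nabla hV ((smoothVF_extendVec v).mono Set.inter_subset_right)
    (hY.mono Set.inter_subset_left)).contMDiffAt (hV.mem_nhds ⟨hx, mem_dom x⟩)

/-- Tensoriality of the curvature in `X` quantifies over fields that are merely differentiable at
the point. Smoothness is needed only of `Y`, through the smooth endomorphism field `∇Y`. -/
theorem diffAt_nabla (hU : IsOpen U) (hY : SmoothVF U Y) (hx : x ∈ U) (hX : DiffAt X x) :
    DiffAt (g.nabla X Y) x :=
  MDifferentiableAt.clm_bundle_apply (b := id)
    ((g.contMDiffAt_leviCivita hU hY hx).mdifferentiableAt (by simp)) hX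

theorem nabla_sub_nabla (hX : DiffAt X x) (hY : DiffAt Y x) :
    g.nabla X Y x - g.nabla Y X x = mlieBracket (𝓡 4) X Y x :=
  (CovariantDerivative.torsion_eq_zero_iff g.leviCivita).1 g.leviCivita_torsion hX hY

theorem lie_val (hX : DiffAt X x) (hY : DiffAt Y x) (hZ : DiffAt Z x) :
    lie X (fun y ↦ g.val y (Y y) (Z y)) x
      = g.val x (g.nabla X Y x) (Z x) + g.val x (Y x) (g.nabla X Z x) :=
  g.leviCivita_metric hX hY hZ

theorem nabla_add (hX : DiffAt X x) (hY : DiffAt Y x) :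
    g.leviCivita (X + Y) x = g.leviCivita X x + g.leviCivita Y x :=
  g.leviCivita.isCovariantDerivativeOn.add hX hY (Set.mem_univ x)

theorem nabla_smul (hf : MDifferentiableAt (𝓡 4) 𝓘(ℝ) f x) (hX : DiffAt X x) :
    g.leviCivita (f • X) x = f x • g.leviCivita X x + (mvfderiv (𝓡 4) f x).smulRight (X x) :=
  g.leviCivita.isCovariantDerivativeOn.leibniz hX hf (Set.mem_univ x)

theorem nabla_congr (hU : IsOpen U) (hx : x ∈ U) (hX : DiffAt X x) (hY : DiffAt Y x)
    (h : Set.EqOn X Y U) : g.leviCivita X x = g.leviCivita Y x :=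
  g.leviCivita.isCovariantDerivativeOn.congr_of_eqOn hX hY (hU.mem_nhds hx) fun _ hy ↦ h hy

end PseudoRiemannianMetric

theorem mvfderiv_congr_of_eqOn (hU : IsOpen U) (hx : x ∈ U) (hfh : Set.EqOn f h U) :
    mvfderiv (𝓡 4) f x = mvfderiv (𝓡 4) h x := by
  have : f =ᶠ[nhds x] h := Filter.eventuallyEq_of_mem (hU.mem_nhds hx) hfh
  simp only [mvfderiv, this.mfderiv_eq]
  rfl

/-! ### The Riemann tensor and its symmetries. -/

namespace PseudoRiemannianMetric

variable (g : PseudoRiemannianMetric M)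

/-- The curvature operator `-(∇_X ∇_Y Z - ∇_Y ∇_X Z - ∇_{[X, Y]} Z)` on vector fields. -/
def curv (X Y Z : Π y : M, TangentSpace (𝓡 4) y) (x : M) : TangentSpace (𝓡 4) x :=
  -(g.leviCivita (g.nabla Y Z) x (X x) - g.leviCivita (g.nabla X Z) x (Y x)
    - g.leviCivita Z x (mlieBracket (𝓡 4) X Y x))

theorem riemann_eq_curv (u v w : TangentSpace (𝓡 4) x) :
    riemann g.leviCivita x u v w = g.curv (extendVec u) (extendVec v) (extendVec w) x := by
  simp [riemann, curv]

theorem curv_swap (X Y Z : Π y : M, TangentSpace (𝓡 4) y) (x : M) :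
    g.curv X Y Z x = -g.curv Y X Z x := by
  simp only [curv]
  rw [mlieBracket_swap_apply (V := X), map_neg]
  abel

/-- Since the torsion vanishes, each group `∇_A ∇_B C - ∇_A ∇_C B - ∇_{[B, C]} A` of the cyclic sum
equals `[A, [B, C]]`, and the sum vanishes by the Jacobi identity. -/
theorem curv_bianchi (hU : IsOpen U) (hX : SmoothVF U X) (hY : SmoothVF U Y) (hZ : SmoothVF U Z)
    (hx : x ∈ U) : g.curv X Y Z x + g.curv Y Z X x + g.curv Z X Y x = 0 := by
  have key : ∀ {A B C : Π y : M, TangentSpace (𝓡 4) y}, SmoothVF U A → SmoothVF U B →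
      SmoothVF U C → g.leviCivita (g.nabla B C) x (A x) - g.leviCivita (g.nabla C B) x (A x)
        - g.leviCivita A x (mlieBracket (𝓡 4) B C x)
        = mlieBracket (𝓡 4) A (mlieBracket (𝓡 4) B C) x := by
    intro A B C hA hB hC
    have hBC := hB.bracket hU hC
    rw [← g.nabla_sub_nabla (hA.diffAt hU hx) (hBC.diffAt hU hx)]
    congr 1
    rw [sub_eq_iff_eq_add', nabla, ← _root_.add_apply,
      ← g.nabla_add ((g.smoothVF_nabla hU hC hB).diffAt hU hx) (hBC.diffAt hU hx)]
    congr 1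
    refine g.nabla_congr hU hx ((g.smoothVF_nabla hU hB hC).diffAt hU hx)
      (((g.smoothVF_nabla hU hC hB).add hBC).diffAt hU hx) fun y hy ↦ ?_
    rw [Pi.add_apply, ← g.nabla_sub_nabla (hB.diffAt hU hy) (hC.diffAt hU hy)]
    abel
  have at_ : ∀ {A : Π y : M, TangentSpace (𝓡 4) y}, SmoothVF U A →
      ContMDiffAt (𝓡 4) ((𝓡 4).prod 𝓘(ℝ, E4)) (minSmoothness ℝ 2)
        (fun y ↦ Bundle.TotalSpace.mk' E4 (E := TangentSpace (𝓡 4)) y (A y)) x := by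
    intro A hA
    exact (hA.contMDiffAt (hU.mem_nhds hx)).of_le
      (by simpa using! (ENat.LEInfty.out : (2 : ℕ∞ω) ≤ ∞))
  have J := leibniz_identity_mlieBracket_apply (at_ hX) (at_ hY) (at_ hZ)
  rw [mlieBracket_swap_apply (V := mlieBracket (𝓡 4) X Y)] at J
  have e : mlieBracket (𝓡 4) Y (mlieBracket (𝓡 4) X Z) x
      = -mlieBracket (𝓡 4) Y (mlieBracket (𝓡 4) Z X) x := by
    rw [mlieBracket_swap (V := X) (W := Z)]
    have := mlieBracket_const_smul_right (I := 𝓡 4) (x := x) (V := Y) (c := (-1 : ℝ))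
      ((hZ.bracket hU hX).diffAt hU hx)
    simpa using this
  rw [e, ← key hX hY hZ, ← key hY hZ hX, ← key hZ hX hY] at J
  simp only [curv]
  rw [← sub_eq_zero] at J
  rw [← neg_eq_zero, ← J]
  module

/-- Differentiate `g(Z, W)` along two fields using metric compatibility and antisymmetrise: the
mixed terms cancel, and `lie_comm` evaluates the commutator of derivatives. -/
theorem val_curv_swap (hU : IsOpen U) (hX : SmoothVF U X) (hY : SmoothVF U Y) (hZ : SmoothVF U Z)
    (hW : SmoothVF U W) (hx : x ∈ U) :
    g.val x (g.curv X Y Z x) (W x) = -g.val x (g.curv X Y W x) (Z x) := by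
  have key : ∀ {A B : Π y : M, TangentSpace (𝓡 4) y}, SmoothVF U A → SmoothVF U B →
      lie A (lie B fun y ↦ g.val y (Z y) (W y)) x
        = g.val x (g.nabla A (g.nabla B Z) x) (W x) + g.val x (g.nabla B Z x) (g.nabla A W x)
          + (g.val x (g.nabla A Z x) (g.nabla B W x)
            + g.val x (Z x) (g.nabla A (g.nabla B W) x)) := by
    intro A B hA hB
    have hBZ := g.smoothVF_nabla hU hB hZ
    have hBW := g.smoothVF_nabla hU hB hW
    rw [← g.lie_val (hA.diffAt hU hx) (hBZ.diffAt hU hx) (hW.diffAt hU hx),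
      ← g.lie_val (hA.diffAt hU hx) (hZ.diffAt hU hx) (hBW.diffAt hU hx), lie, lie, lie,
      ← _root_.add_apply, ← mvfderiv_fun_add ((g.smoothFun_val hBZ hW).mdiffAt hU hx)
        ((g.smoothFun_val hZ hBW).mdiffAt hU hx)]
    congr 1
    exact mvfderiv_congr_of_eqOn hU hx fun y hy ↦
      g.lie_val (hB.diffAt hU hy) (hZ.diffAt hU hy) (hW.diffAt hU hy)
  have h := lie_comm hU hX hY (g.smoothFun_val hZ hW) hx
  rw [key hX hY, key hY hX, g.lie_val ((hX.bracket hU hY).diffAt hU hx) (hZ.diffAt hU hx)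
    (hW.diffAt hU hx)] at h
  rw [g.symm x (g.curv X Y W x)]
  simp only [curv, map_neg, map_sub, _root_.neg_apply, _root_.sub_apply]
  linarith

/-- The classical octahedron argument: pair symmetry is a combination of four Bianchi identities and
the two antisymmetries. -/
theorem val_curv_pair (hU : IsOpen U) (hX : SmoothVF U X) (hY : SmoothVF U Y) (hZ : SmoothVF U Z)
    (hW : SmoothVF U W) (hx : x ∈ U) :
    g.val x (g.curv X Y Z x) (W x) = g.val x (g.curv Z W X x) (Y x) := by
  have b : ∀ {A B C D : Π y : M, TangentSpace (𝓡 4) y}, SmoothVF U A → SmoothVF U B →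
      SmoothVF U C → g.val x (g.curv A B C x) (D x) + g.val x (g.curv B C A x) (D x)
        + g.val x (g.curv C A B x) (D x) = 0 := by
    intro A B C D hA hB hC
    have := congrArg (fun v ↦ g.val x v (D x)) (g.curv_bianchi hU hA hB hC hx)
    simpa using this
  have s : ∀ (A B C D : Π y : M, TangentSpace (𝓡 4) y),
      g.val x (g.curv A B C x) (D x) = -g.val x (g.curv B A C x) (D x) := by
    intro A B C D
    rw [g.curv_swap A B]; simp
  have t : ∀ {A B C D : Π y : M, TangentSpace (𝓡 4) y}, SmoothVF U A → SmoothVF U B →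
      SmoothVF U C → SmoothVF U D →
      g.val x (g.curv A B C x) (D x) = -g.val x (g.curv A B D x) (C x) :=
    fun hA hB hC hD ↦ g.val_curv_swap hU hA hB hC hD hx
  have b1 := b (D := W) hX hY hZ
  have b2 := b (D := X) hY hZ hW
  have b3 := b (D := Y) hZ hW hX
  have b4 := b (D := Z) hW hX hY
  have := s Y Z X W
  have := s Z X Y W
  have := s X Y Z W
  linarith [t hX hY hZ hW, t hY hZ hX hW, t hZ hX hY hW, t hY hZ hW hX, t hZ hW hY hX,
    t hW hY hZ hX, t hZ hW hX hY, t hW hX hZ hY, t hX hZ hW hY, t hW hX hY hZ, t hX hY hW hZ,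
    t hY hW hX hZ, s X Z Y W, s X Z W Y, s Y W Z X, s Y W X Z, s X W Y Z, s X W Z Y]

theorem curv_tensorial (hU : IsOpen U) (hZ : SmoothVF U Z) (hx : x ∈ U) :
    TensorialAt (𝓡 4) E4 (fun X ↦ g.curv X Y Z x) x where
  smul {f X} hf hX := by
    have hXZ := g.diffAt_nabla hU hZ hx hX
    have e : g.nabla (f • X) Z = f • g.nabla X Z := by funext y; simp [nabla]
    simp only [curv, e]
    rw [g.nabla_smul hf hXZ, mlieBracket_smul_left hf hX]
    simp
    module
  add {X X'} hX hX' := by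
    have e : g.nabla (X + X') Z = g.nabla X Z + g.nabla X' Z := by funext y; simp [nabla]
    simp only [curv, e]
    rw [g.nabla_add (g.diffAt_nabla hU hZ hx hX) (g.diffAt_nabla hU hZ hx hX'),
      mlieBracket_add_left hX hX']
    simp
    module

/-- The curvature operator is the Riemann tensor. -/
theorem curv_eq_riemann (hU : IsOpen U) (hX : SmoothVF U X) (hY : SmoothVF U Y)
    (hZ : SmoothVF U Z) (hx : x ∈ U) :
    g.curv X Y Z x = riemann g.leviCivita x (X x) (Y x) (Z x) := by
  rw [riemann_eq_curv]
  have hV : IsOpen (U ∩ dom x) := hU.inter (isOpen_dom x)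
  have hxV : x ∈ U ∩ dom x := ⟨hx, mem_dom x⟩
  replace hX := hX.mono (V := U ∩ dom x) Set.inter_subset_left
  replace hY := hY.mono (V := U ∩ dom x) Set.inter_subset_left
  replace hZ := hZ.mono (V := U ∩ dom x) Set.inter_subset_left
  have ext : ∀ v : TangentSpace (𝓡 4) x, SmoothVF (U ∩ dom x) (extendVec v) :=
    fun v ↦ (smoothVF_extendVec v).mono Set.inter_subset_right
  have left : ∀ {A A' B C : Π y : M, TangentSpace (𝓡 4) y}, SmoothVF (U ∩ dom x) A →
      SmoothVF (U ∩ dom x) A' → SmoothVF (U ∩ dom x) C → A x = A' x →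
      g.curv A B C x = g.curv A' B C x := fun hA hA' hC h ↦
    (g.curv_tensorial hV hC hxV).pointwise (hA.diffAt hV hxV)
      (hA'.diffAt hV hxV) h
  refine g.ext_val fun w ↦ ?_
  -- Tensoriality is available in the first slot only. The second slot is brought there by
  -- antisymmetry, the third by pair symmetry.
  rw [left hX (ext (X x)) hZ (by simp), g.curv_swap,
    left hY (ext (Y x)) hZ (by simp), ← g.curv_swap, ← extendVec_self w,
    g.val_curv_pair hV (ext (X x)) (ext (Y x)) hZ (ext w) hxV,
    left hZ (ext (Z x)) (ext (X x)) (by simp),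
    ← g.val_curv_pair hV (ext (X x)) (ext (Y x)) (ext (Z x)) (ext w) hxV]

/-- The Riemann tensor with all indices lowered. -/
def rm (x : M) (u v w z : TangentSpace (𝓡 4) x) : ℝ := g.val x (riemann g.leviCivita x u v w) z

theorem rm_eq (hU : IsOpen U) (hX : SmoothVF U X) (hY : SmoothVF U Y) (hZ : SmoothVF U Z)
    (W : Π y : M, TangentSpace (𝓡 4) y) (hx : x ∈ U) :
    g.rm x (X x) (Y x) (Z x) (W x) = g.val x (g.curv X Y Z x) (W x) := by
  rw [g.curv_eq_riemann hU hX hY hZ hx, rm]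

theorem rm_swap (x : M) (u v w z : TangentSpace (𝓡 4) x) : g.rm x u v w z = -g.rm x v u w z := by
  simp only [rm, riemann_eq_curv]
  rw [g.curv_swap]; simp

theorem rm_pair (x : M) (u v w z : TangentSpace (𝓡 4) x) : g.rm x u v w z = g.rm x w z u v := by
  have := g.val_curv_pair (isOpen_dom x) (smoothVF_extendVec u) (smoothVF_extendVec v)
    (smoothVF_extendVec w) (smoothVF_extendVec z) (mem_dom x)
  simpa [rm, riemann_eq_curv] using this

theorem rm_bianchi (x : M) (u v w z : TangentSpace (𝓡 4) x) :
    g.rm x u v w z + g.rm x v w u z + g.rm x w u v z = 0 := by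
  have := congrArg (fun v ↦ g.val x v z) (g.curv_bianchi (isOpen_dom x) (smoothVF_extendVec u)
    (smoothVF_extendVec v) (smoothVF_extendVec w) (mem_dom x))
  simpa [rm, riemann_eq_curv] using this

theorem isLinearMap_rm (x : M) (v w z : TangentSpace (𝓡 4) x) :
    IsLinearMap ℝ (fun u ↦ g.rm x u v w z) := by
  have hT := g.curv_tensorial (Y := extendVec v) (isOpen_dom x) (smoothVF_extendVec w) (mem_dom x)
  have : (fun u ↦ g.rm x u v w z) = fun u ↦ g.val x (TensorialAt.mkHom _ x hT u) z := by
    funext u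
    rw [TensorialAt.mkHom_apply_eq_extend, rm, riemann_eq_curv]
  rw [this]
  exact ⟨fun a b ↦ by simp, fun c a ↦ by simp⟩

end PseudoRiemannianMetric

theorem _root_.IsLinearMap.finsetSum {V ι : Type*} [AddCommGroup V] [Module ℝ V] {s : Finset ι}
    {F : ι → V → ℝ} (hF : ∀ i ∈ s, IsLinearMap ℝ (F i)) :
    IsLinearMap ℝ (fun v ↦ ∑ i ∈ s, F i v) where
  map_add a b := by
    rw [← Finset.sum_add_distrib]
    exact Finset.sum_congr rfl fun i hi ↦ (hF i hi).map_add a b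
  map_smul c a := by
    rw [smul_eq_mul, Finset.mul_sum]
    exact Finset.sum_congr rfl fun i hi ↦ (hF i hi).map_smul c a

theorem _root_.IsLinearMap.sub_fun {V : Type*} [AddCommGroup V] [Module ℝ V] {F G : V → ℝ}
    (hF : IsLinearMap ℝ F) (hG : IsLinearMap ℝ G) : IsLinearMap ℝ (fun v ↦ F v - G v) :=
  (IsLinearMap.mk' F hF - IsLinearMap.mk' G hG).isLinear

theorem _root_.IsLinearMap.const_mul {V : Type*} [AddCommGroup V] [Module ℝ V] {F : V → ℝ} (c : ℝ)
    (hF : IsLinearMap ℝ F) : IsLinearMap ℝ (fun v ↦ c * F v) :=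
  (c • IsLinearMap.mk' F hF).isLinear

theorem _root_.IsLinearMap.mul_const {V : Type*} [AddCommGroup V] [Module ℝ V] {F : V → ℝ} (c : ℝ)
    (hF : IsLinearMap ℝ F) : IsLinearMap ℝ (fun v ↦ F v * c) := by
  simpa only [mul_comm] using hF.const_mul c

theorem _root_.IsLinearMap.neg_fun {V : Type*} [AddCommGroup V] [Module ℝ V] {F : V → ℝ}
    (hF : IsLinearMap ℝ F) : IsLinearMap ℝ (fun v ↦ -F v) :=
  (-IsLinearMap.mk' F hF).isLinear

/-! ### The Ricci, Schouten and Weyl tensors. -/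

namespace PseudoRiemannianMetric

variable (g : PseudoRiemannianMetric M)

theorem isLinearMap_val_right (x : M) (v : TangentSpace (𝓡 4) x) :
    IsLinearMap ℝ (fun w ↦ g.val x v w) := (g.val x v).toLinearMap.isLinear

theorem isLinearMap_val_left (x : M) (w : TangentSpace (𝓡 4) x) :
    IsLinearMap ℝ (fun v ↦ g.val x v w) := by
  simpa only [g.symm x w] using g.isLinearMap_val_right x w

theorem isLinearMap_rm₂ (x : M) (u w z : TangentSpace (𝓡 4) x) :
    IsLinearMap ℝ (fun v ↦ g.rm x u v w z) := by
  simpa only [g.rm_swap x u] using (g.isLinearMap_rm x u w z).neg_fun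

theorem isLinearMap_rm₄ (x : M) (u v w : TangentSpace (𝓡 4) x) :
    IsLinearMap ℝ (fun z ↦ g.rm x u v w z) := g.isLinearMap_val_right x _

variable {g} in
theorem DualPair.sum_val {e f : Fin 4 → TangentSpace (𝓡 4) x} (h : g.DualPair x e f) :
    ∑ a, g.val x (e a) (f a) = 4 := by
  rw [h.contract_eq (g.dualPair_up_ptl x) (g.isLinearMap_val_left x) (g.isLinearMap_val_right x)]
  simp_rw [val_up]
  have : ∀ a, dx x a (ptl x a) = 1 := fun a ↦ by
    change (EuclideanSpace.basisFun (Fin 4) ℝ) a a = 1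
    simp
  simp [this]

variable {g} in
theorem DualPair.sum_mul {e f : Fin 4 → TangentSpace (𝓡 4) x} (h : g.DualPair x e f)
    {F : TangentSpace (𝓡 4) x → ℝ} (hF : IsLinearMap ℝ F) (w : TangentSpace (𝓡 4) x) :
    ∑ a, g.val x (e a) w * F (f a) = F w := by
  conv_rhs => rw [← h w]
  change _ = IsLinearMap.mk' F hF _
  simp

/-- The Ricci tensor of the Levi-Civita connection. -/
abbrev ric (x : M) (u w : TangentSpace (𝓡 4) x) : ℝ := ricci g.leviCivita x u w

variable {g} in
theorem DualPair.ric_eq {e f : Fin 4 → TangentSpace (𝓡 4) x} (h : g.DualPair x e f)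
    (u w : TangentSpace (𝓡 4) x) : g.ric x u w = ∑ a, g.rm x u (e a) w (f a) := by
  rw [h.contract_eq (g.dualPair_ptl_up x) (B := fun v z ↦ g.rm x u v w z)
    (fun z ↦ g.isLinearMap_rm₂ x u w z) (fun v ↦ g.isLinearMap_rm₄ x u v w)]
  simp only [ric, ricci, rm, ← g.val_up]
  exact Finset.sum_congr rfl fun a _ ↦ g.symm _ _ _

theorem isLinearMap_ric_left (x : M) (w : TangentSpace (𝓡 4) x) :
    IsLinearMap ℝ (fun u ↦ g.ric x u w) := by
  simp only [(g.dualPair_ptl_up x).ric_eq]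
  exact .finsetSum fun a _ ↦ g.isLinearMap_rm x _ _ _

theorem ric_symm (x : M) (u w : TangentSpace (𝓡 4) x) : g.ric x u w = g.ric x w u := by
  rw [(g.dualPair_ptl_up x).ric_eq, (g.dualPair_up_ptl x).ric_eq]
  exact Finset.sum_congr rfl fun a _ ↦ g.rm_pair _ _ _ _ _

theorem isLinearMap_ric_right (x : M) (u : TangentSpace (𝓡 4) x) :
    IsLinearMap ℝ (fun w ↦ g.ric x u w) := by
  simpa only [g.ric_symm x u] using g.isLinearMap_ric_left x u

variable {g} in
theorem DualPair.scalarCurv_eq {e f : Fin 4 → TangentSpace (𝓡 4) x} (h : g.DualPair x e f) :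
    g.scalarCurv x = ∑ a, g.ric x (e a) (f a) :=
  (g.dualPair_ptl_up x).contract_eq h (g.isLinearMap_ric_left x) (g.isLinearMap_ric_right x)

theorem schouten_symm (x : M) (u w : TangentSpace (𝓡 4) x) : g.schouten x u w = g.schouten x w u := by
  have := g.ric_symm x u w
  simp only [ric] at this
  rw [schouten, schouten, this, g.symm]

theorem isLinearMap_schouten_left (x : M) (w : TangentSpace (𝓡 4) x) :
    IsLinearMap ℝ (fun u ↦ g.schouten x u w) :=
  ((g.isLinearMap_ric_left x w).sub_fun ((g.isLinearMap_val_left x w).const_mul _)).const_mul _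

theorem isLinearMap_schouten_right (x : M) (u : TangentSpace (𝓡 4) x) :
    IsLinearMap ℝ (fun w ↦ g.schouten x u w) := by
  simpa only [g.schouten_symm x u] using g.isLinearMap_schouten_left x u

variable {g} in
theorem DualPair.sum_schouten {e f : Fin 4 → TangentSpace (𝓡 4) x} (h : g.DualPair x e f) :
    ∑ a, g.schouten x (e a) (f a) = g.scalarCurv x / 6 := by
  simp only [schouten, ← Finset.mul_sum, Finset.sum_sub_distrib, h.sum_val]
  rw [h.scalarCurv_eq]
  simp only [ric]
  ring

theorem weyl_eq (x : M) (u v w z : TangentSpace (𝓡 4) x) : g.weyl x u v w z = g.rm x u v w z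
    - (g.schouten x z v * g.val x u w - g.schouten x z u * g.val x v w)
    - (g.val x v z * g.schouten x u w - g.val x u z * g.schouten x v w) := rfl

theorem weyl_swap (x : M) (u v w z : TangentSpace (𝓡 4) x) :
    g.weyl x u v w z = -g.weyl x v u w z := by
  rw [weyl_eq, weyl_eq, g.rm_swap]; ring

theorem weyl_pair (x : M) (u v w z : TangentSpace (𝓡 4) x) :
    g.weyl x u v w z = g.weyl x w z u v := by
  rw [weyl_eq, weyl_eq, g.rm_pair, g.schouten_symm x v z, g.schouten_symm x v w,
    g.schouten_symm x w u, g.schouten_symm x z u, g.symm x w u, g.symm x z u, g.symm x z v,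
    g.symm x w v]
  ring

theorem weyl_bianchi (x : M) (u v w z : TangentSpace (𝓡 4) x) :
    g.weyl x u v w z + g.weyl x v w u z + g.weyl x w u v z = 0 := by
  have := g.rm_bianchi x u v w z
  rw [weyl_eq, weyl_eq, weyl_eq, g.symm x w u, g.symm x v u, g.symm x w v, g.schouten_symm x w u,
    g.schouten_symm x v u, g.schouten_symm x w v]
  linarith

theorem isLinearMap_weyl₁ (x : M) (v w z : TangentSpace (𝓡 4) x) :
    IsLinearMap ℝ (fun u ↦ g.weyl x u v w z) :=
  ((g.isLinearMap_rm x v w z).sub_fun (((g.isLinearMap_val_left x w).const_mul _).sub_fun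
    ((g.isLinearMap_schouten_right x z).mul_const _))).sub_fun
    (((g.isLinearMap_schouten_left x w).const_mul _).sub_fun
    ((g.isLinearMap_val_left x z).mul_const _))

theorem isLinearMap_weyl₂ (x : M) (u w z : TangentSpace (𝓡 4) x) :
    IsLinearMap ℝ (fun v ↦ g.weyl x u v w z) := by
  simpa only [g.weyl_swap x u] using (g.isLinearMap_weyl₁ x u w z).neg_fun

theorem isLinearMap_weyl₃ (x : M) (u v z : TangentSpace (𝓡 4) x) :
    IsLinearMap ℝ (fun w ↦ g.weyl x u v w z) := by
  simpa only [g.weyl_pair x u v] using g.isLinearMap_weyl₁ x z u v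

theorem isLinearMap_weyl₄ (x : M) (u v w : TangentSpace (𝓡 4) x) :
    IsLinearMap ℝ (fun z ↦ g.weyl x u v w z) := by
  simpa only [g.weyl_pair x u v] using g.isLinearMap_weyl₂ x w u v

variable {g} in
/-- The Weyl tensor is trace free. -/
theorem DualPair.sum_weyl {e f : Fin 4 → TangentSpace (𝓡 4) x} (h : g.DualPair x e f)
    (u w : TangentSpace (𝓡 4) x) : ∑ a, g.weyl x u (e a) w (f a) = 0 := by
  have h1 := h.ric_eq u w
  have h2 := h.sum_val
  have h3 := h.sum_schouten
  have h4 := h.sum_mul (g.isLinearMap_schouten_left x u) w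
  have h5 : ∑ a, g.val x u (f a) * g.schouten x (e a) w = g.schouten x u w := by
    simp only [g.symm x u]
    exact h.swap.sum_mul (g.isLinearMap_schouten_left x w) u
  have h6 : g.schouten x u w
      = 1 / 2 * (g.ric x u w - 1 / 6 * g.scalarCurv x * g.val x u w) := rfl
  -- In dimension four the trace is `Ric - (tr L) g + L - (4 - 1) L = Ric - R g / 6 - 2 L`, which is
  -- zero by the normalisation of `L`.
  simp only [weyl_eq, Finset.sum_sub_distrib, ← Finset.sum_mul, ← h1, h2, h5]
  simp only [fun a ↦ g.schouten_symm x (f a) (e a), h3]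
  simp only [mul_comm (g.schouten x (f _) u), h4, g.schouten_symm x w u]
  linarith

/-! ### Smoothness of the curvature tensors -/

theorem smoothVF_curv (hU : IsOpen U) (hX : SmoothVF U X) (hY : SmoothVF U Y)
    (hZ : SmoothVF U Z) : SmoothVF U (g.curv X Y Z) := by
  have h := ((g.smoothVF_nabla hU hX (g.smoothVF_nabla hU hY hZ)).sub
    (g.smoothVF_nabla hU hY (g.smoothVF_nabla hU hX hZ))).sub
    (g.smoothVF_nabla hU (hX.bracket hU hY) hZ)
  exact ContMDiffOn.neg_section h

theorem smoothFun_rm (hU : IsOpen U) (hX : SmoothVF U X) (hY : SmoothVF U Y)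
    (hZ : SmoothVF U Z) (hW : SmoothVF U W) :
    SmoothFun U (fun y ↦ g.rm y (X y) (Y y) (Z y) (W y)) :=
  (g.smoothFun_val (g.smoothVF_curv hU hX hY hZ) hW).congr fun _ hy ↦ g.rm_eq hU hX hY hZ W hy

theorem smoothFun_ric (hU : IsOpen U) {x : M} (hUx : U ⊆ dom x) (hX : SmoothVF U X)
    (hY : SmoothVF U Y) : SmoothFun U (fun y ↦ g.ric y (X y) (Y y)) :=
  (SmoothFun.finsetSum fun i (_ : i ∈ Finset.univ) ↦ g.smoothFun_rm hU hX
    ((smoothVF_loc x i).mono hUx) hY ((g.smoothVF_coloc x i).mono hUx)).congr fun _ hy ↦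
      (g.dualPair_loc_coloc (hUx hy)).ric_eq _ _

theorem smoothFun_scalarCurv (hU : IsOpen U) {x : M} (hUx : U ⊆ dom x) :
    SmoothFun U g.scalarCurv :=
  (SmoothFun.finsetSum fun i (_ : i ∈ Finset.univ) ↦ g.smoothFun_ric hU hUx
    ((smoothVF_loc x i).mono hUx) ((g.smoothVF_coloc x i).mono hUx)).congr fun _ hy ↦
      (g.dualPair_loc_coloc (hUx hy)).scalarCurv_eq

theorem smoothFun_schouten (hU : IsOpen U) {x : M} (hUx : U ⊆ dom x) (hX : SmoothVF U X)
    (hY : SmoothVF U Y) : SmoothFun U (fun y ↦ g.schouten y (X y) (Y y)) :=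
  (SmoothFun.const _).mul ((g.smoothFun_ric hU hUx hX hY).sub
    (((SmoothFun.const _).mul (g.smoothFun_scalarCurv hU hUx)).mul (g.smoothFun_val hX hY)))

theorem smoothFun_weyl (hU : IsOpen U) {x : M} (hUx : U ⊆ dom x) (hX : SmoothVF U X)
    (hY : SmoothVF U Y) (hZ : SmoothVF U Z) (hW : SmoothVF U W) :
    SmoothFun U (fun y ↦ g.weyl y (X y) (Y y) (Z y) (W y)) :=
  have hL {A B} (hA : SmoothVF U A) (hB : SmoothVF U B) := g.smoothFun_schouten hU hUx hA hB
  have hg {A B} (hA : SmoothVF U A) (hB : SmoothVF U B) := g.smoothFun_val hA hB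
  ((g.smoothFun_rm hU hX hY hZ hW).sub (((hL hW hY).mul (hg hX hZ)).sub
    ((hL hW hX).mul (hg hY hZ)))).sub (((hg hY hW).mul (hL hX hZ)).sub ((hg hX hW).mul (hL hY hZ)))

/-- Needed for the tensoriality of `∇L`, which involves fields differentiable only at `x`. Expanding
both fields in a coordinate frame reduces the claim to the smooth components of `L`. -/
theorem mdiffAt_schouten (hY : DiffAt Y x) (hZ : DiffAt Z x) :
    MDifferentiableAt (𝓡 4) 𝓘(ℝ) (fun y ↦ g.schouten y (Y y) (Z y)) x := by
  have h : MDifferentiableAt (𝓡 4) 𝓘(ℝ) (fun y ↦ ∑ i, ∑ j, g.val y (g.coloc x i y) (Y y)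
      * (g.val y (g.coloc x j y) (Z y) * g.schouten y (loc x i y) (loc x j y))) x := by
    have hs : ∀ {F : Fin 4 → M → ℝ}, (∀ i, MDifferentiableAt (𝓡 4) 𝓘(ℝ) (F i) x) →
        MDifferentiableAt (𝓡 4) 𝓘(ℝ) (fun y ↦ ∑ i, F i y) x := fun hF ↦ by
      simpa only [← Finset.sum_apply] using MDifferentiableAt.sum fun i _ ↦ hF i
    refine hs fun i ↦ hs fun j ↦ ?_
    have hc := fun i ↦ (g.smoothVF_coloc x i).diffAt (isOpen_dom x) (mem_dom x)
    exact (g.mdifferentiableAt_val (hc i) hY).mul ((g.mdifferentiableAt_val (hc j) hZ).mul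
      ((g.smoothFun_schouten (isOpen_dom x) subset_rfl (smoothVF_loc x i)
        (smoothVF_loc x j)).mdiffAt (isOpen_dom x) (mem_dom x)))
  refine h.congr_of_eventuallyEq ?_
  filter_upwards [(isOpen_dom x).mem_nhds (mem_dom x)] with y hy
  have hd := g.dualPair_coloc_loc hy
  simp_rw [← Finset.mul_sum, hd.sum_mul (g.isLinearMap_schouten_right y _) (Z y)]
  exact (hd.sum_mul (g.isLinearMap_schouten_left y (Z y)) (Y y)).symm

/-! ### The covariant derivative of the Schouten tensor. -/

/-- The covariant derivative `∇_m L` of the Schouten tensor, evaluated on vector fields. -/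
def covSch (x : M) (m : TangentSpace (𝓡 4) x) (Y Z : Π y : M, TangentSpace (𝓡 4) y) : ℝ :=
  mvfderiv (𝓡 4) (fun y ↦ g.schouten y (Y y) (Z y)) x m
    - g.schouten x (g.leviCivita Y x m) (Z x) - g.schouten x (Y x) (g.leviCivita Z x m)

theorem covSch_tensorial₁ (m : TangentSpace (𝓡 4) x) (hZ : DiffAt Z x) :
    TensorialAt (𝓡 4) E4 (fun Y ↦ g.covSch x m Y Z) x where
  smul {f Y} hf hY := by
    have e : (fun y ↦ g.schouten y ((f • Y) y) (Z y)) = fun y ↦ f y * g.schouten y (Y y) (Z y) :=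
      funext fun y ↦ (g.isLinearMap_schouten_left y _).map_smul _ _
    simp only [covSch, e]
    rw [mvfderiv_fun_mul hf (g.mdiffAt_schouten hY hZ), g.nabla_smul hf hY]
    simp [(g.isLinearMap_schouten_left x _).map_smul, (g.isLinearMap_schouten_left x _).map_add]
    ring
  add {Y Y'} hY hY' := by
    have e : (fun y ↦ g.schouten y ((Y + Y') y) (Z y))
        = fun y ↦ g.schouten y (Y y) (Z y) + g.schouten y (Y' y) (Z y) :=
      funext fun y ↦ (g.isLinearMap_schouten_left y _).map_add _ _
    simp only [covSch, e]
    rw [mvfderiv_fun_add (g.mdiffAt_schouten hY hZ) (g.mdiffAt_schouten hY' hZ), g.nabla_add hY hY']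
    simp [(g.isLinearMap_schouten_left x _).map_add]
    ring

theorem covSch_symm (m : TangentSpace (𝓡 4) x) (Y Z : Π y : M, TangentSpace (𝓡 4) y) :
    g.covSch x m Y Z = g.covSch x m Z Y := by
  simp only [covSch, fun y ↦ g.schouten_symm y (Y y)]
  rw [g.schouten_symm x _ (Z x)]
  ring

theorem covSch_tensorial₂ (m : TangentSpace (𝓡 4) x) (hY : DiffAt Y x) :
    TensorialAt (𝓡 4) E4 (fun Z ↦ g.covSch x m Y Z) x := by
  simpa only [g.covSch_symm m Y] using g.covSch_tensorial₁ m hY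

/-- By tensoriality the chart-constant extensions in `covSchouten` may be exchanged for any
differentiable fields, in particular for frames that are smooth around a point. -/
theorem covSchouten_eq (m : TangentSpace (𝓡 4) x) (hY : DiffAt Y x) (hZ : DiffAt Z x) :
    g.covSchouten x m (Y x) (Z x) = g.covSch x m Y Z := by
  rw [← TensorialAt.mkHom₂_apply (fun _ h ↦ g.covSch_tensorial₁ m h)
    (fun _ h ↦ g.covSch_tensorial₂ m h) hY hZ, TensorialAt.mkHom₂_apply_eq_extend]
  simp [covSch, covSchouten]

theorem isLinearMap_covSchouten₁ (x : M) (p a : TangentSpace (𝓡 4) x) :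
    IsLinearMap ℝ (fun m ↦ g.covSchouten x m p a) where
  map_add m m' := by
    simp only [covSchouten, map_add, (g.isLinearMap_schouten_left x _).map_add,
      (g.isLinearMap_schouten_right x _).map_add]
    ring
  map_smul c m := by
    simp only [covSchouten, map_smul, (g.isLinearMap_schouten_left x _).map_smul,
      (g.isLinearMap_schouten_right x _).map_smul, smul_eq_mul]
    ring

theorem covSchouten_eq_mkHom₂ (x : M) (m p a : TangentSpace (𝓡 4) x) :
    g.covSchouten x m p a = TensorialAt.mkHom₂ (fun Y Z ↦ g.covSch x m Y Z) x
      (fun _ h ↦ g.covSch_tensorial₁ m h) (fun _ h ↦ g.covSch_tensorial₂ m h) p a := by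
  rw [TensorialAt.mkHom₂_apply_eq_extend]
  simp [covSch, covSchouten]

theorem isLinearMap_covSchouten₂ (x : M) (m a : TangentSpace (𝓡 4) x) :
    IsLinearMap ℝ (fun p ↦ g.covSchouten x m p a) := by
  simp only [covSchouten_eq_mkHom₂]
  exact ⟨fun _ _ ↦ by simp, fun _ _ ↦ by simp⟩

theorem isLinearMap_covSchouten₃ (x : M) (m p : TangentSpace (𝓡 4) x) :
    IsLinearMap ℝ (fun a ↦ g.covSchouten x m p a) := by
  simp only [covSchouten_eq_mkHom₂]
  exact ⟨fun _ _ ↦ by simp, fun _ _ ↦ by simp⟩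

theorem smoothFun_covSchouten (hU : IsOpen U) {x : M} (hUx : U ⊆ dom x) (hX : SmoothVF U X)
    (hY : SmoothVF U Y) (hZ : SmoothVF U Z) :
    SmoothFun U (fun y ↦ g.covSchouten y (X y) (Y y) (Z y)) := by
  have h := (((g.smoothFun_schouten hU hUx hY hZ).lie hU hX).sub
    (g.smoothFun_schouten hU hUx (g.smoothVF_nabla hU hX hY) hZ)).sub
    (g.smoothFun_schouten hU hUx hY (g.smoothVF_nabla hU hX hZ))
  exact h.congr fun y hy ↦ g.covSchouten_eq _ (hY.diffAt hU hy) (hZ.diffAt hU hy)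

end PseudoRiemannianMetric

/-! ### The quadratic Weyl identity in dimension four. -/

/-- A tensor with the symmetries of the Weyl tensor in dimension four is determined by ten numbers:
its components in an orthogonal basis, where `q i` is the inverse of the square of the `i`-th
basis vector. -/
theorem weyl_components (q : Fin 4 → ℝ) (C : Fin 4 → Fin 4 → Fin 4 → Fin 4 → ℝ)
    (hq : ∀ i, q i ≠ 0)
    (h₁ : ∀ a b c d, C a b c d = -C b a c d) (h₂ : ∀ a b c d, C a b c d = C c d a b)
    (h₃ : ∀ a b c d, C a b c d + C b c a d + C c a b d = 0)
    (h₄ : ∀ a c, ∑ b, q b * C a b c b = 0) :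
    ∃ s₁ s₂ s₃ s₄ s₅ s₆ α β μ ν : ℝ,
      (C 0 1 0 1 = q 2 * q 3 * α ∧ C 0 1 0 2 = q 3 * s₄ ∧ C 0 1 0 3 = q 2 * s₅ ∧
        C 0 1 1 2 = q 3 * s₂ ∧ C 0 1 1 3 = q 2 * s₃ ∧ C 0 1 2 3 = μ) ∧
      (C 0 2 0 2 = q 1 * q 3 * β ∧ C 0 2 0 3 = q 1 * s₆ ∧ C 0 2 1 2 = q 3 * s₁ ∧ C 0 2 1 3 = ν ∧
        C 0 2 2 3 = -q 1 * s₃) ∧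
      (C 0 3 0 3 = -(q 1 * q 2 * (α + β)) ∧ C 0 3 1 2 = ν - μ ∧ C 0 3 1 3 = -q 2 * s₁ ∧
        C 0 3 2 3 = q 1 * s₂) ∧
      (C 1 2 1 2 = -(q 0 * q 3 * (α + β)) ∧ C 1 2 1 3 = -q 0 * s₆ ∧ C 1 2 2 3 = q 0 * s₅) ∧
      (C 1 3 1 3 = q 0 * q 2 * β ∧ C 1 3 2 3 = -q 0 * s₄) ∧ C 2 3 2 3 = q 0 * q 1 * α := by
  have h₅ : ∀ a b c d, C a b c d = -C a b d c := fun a b c d ↦ by rw [h₂, h₁, h₂]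
  have z : ∀ a c d, C a a c d = 0 := fun a c d ↦ by linarith [h₁ a a c d]
  have z' : ∀ a c d, C c d a a = 0 := fun a c d ↦ by rw [h₂, z]
  simp only [Fin.sum_univ_four] at h₄
  have t01 := h₄ 0 1
  have t02 := h₄ 0 2
  have t03 := h₄ 0 3
  have t12 := h₄ 1 2
  have t13 := h₄ 1 3
  have t23 := h₄ 2 3
  have t00 := h₄ 0 0
  have t11 := h₄ 1 1
  have t22 := h₄ 2 2
  have t33 := h₄ 3 3
  have b := h₃ 0 1 2 3
  simp only [z, z', h₁ 1 0, h₁ 2 0, h₁ 3 0, h₁ 2 1, h₁ 3 1, h₁ 3 2, h₅ _ _ 1 0, h₅ _ _ 2 0,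
    h₅ _ _ 3 0, h₅ _ _ 2 1, h₅ _ _ 3 1, h₅ _ _ 3 2, h₂ 1 2 0,
    mul_neg, neg_neg, mul_zero, zero_add, add_zero] at t01 t02 t03 t12 t13 t23 t00 t11 t22 t33 b
  have q0 := hq 0
  have q1 := hq 1
  have q2 := hq 2
  have q3 := hq 3
  -- Trace-freeness makes the weighted components `q i * q j * C i j i j` of complementary planes
  -- equal. Together with `t00`, the six of them depend only on `α` and `β`.
  have hα : q 0 * q 1 * C 0 1 0 1 = q 2 * q 3 * C 2 3 2 3 := by
    linear_combination (1 / 2) * (q 0 * t00 + q 1 * t11 - q 2 * t22 - q 3 * t33)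
  have hβ : q 0 * q 2 * C 0 2 0 2 = q 1 * q 3 * C 1 3 1 3 := by
    linear_combination (1 / 2) * (q 0 * t00 + q 2 * t22 - q 1 * t11 - q 3 * t33)
  have hγ : q 0 * q 3 * C 0 3 0 3 = q 1 * q 2 * C 1 2 1 2 := by
    linear_combination (1 / 2) * (q 0 * t00 + q 3 * t33 - q 1 * t11 - q 2 * t22)
  -- Dividing by the weights makes all 21 components polynomial in the parameters and the `q i`, so
  -- identities quadratic in `C` can be checked by `ring`.
  refine ⟨C 0 2 1 2 / q 3, C 0 1 1 2 / q 3, C 0 1 1 3 / q 2, C 0 1 0 2 / q 3, C 0 1 0 3 / q 2,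
    C 0 2 0 3 / q 1, C 0 1 0 1 / (q 2 * q 3), C 0 2 0 2 / (q 1 * q 3), C 0 1 2 3, C 0 2 1 3,
    ⟨?_, ?_, ?_, ?_, ?_, ?_⟩, ⟨?_, ?_, ?_, ?_, ?_⟩, ⟨?_, ?_, ?_, ?_⟩, ⟨?_, ?_, ?_⟩, ⟨?_, ?_⟩, ?_⟩
  all_goals try field_simp
  all_goals try linarith
  linear_combination q 0 * t00 - hγ

/-- The four-dimensional identity `4 C_i^{abc} C_{jabc} = (C · C) g_{ij}` in an orthogonal basis. -/
theorem weyl_contraction_orthogonal (q : Fin 4 → ℝ) (C : Fin 4 → Fin 4 → Fin 4 → Fin 4 → ℝ)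
    (hq : ∀ i, q i ≠ 0)
    (h₁ : ∀ a b c d, C a b c d = -C b a c d) (h₂ : ∀ a b c d, C a b c d = C c d a b)
    (h₃ : ∀ a b c d, C a b c d + C b c a d + C c a b d = 0)
    (h₄ : ∀ a c, ∑ b, q b * C a b c b = 0) (i j : Fin 4) :
    4 * (q i * ∑ a, ∑ b, ∑ c, q a * q b * q c * (C i a b c * C j a b c)) =
      if i = j then ∑ d, q d * ∑ a, ∑ b, ∑ c, q a * q b * q c * (C d a b c * C d a b c) else 0 := by
  have h₅ : ∀ a b c d, C a b c d = -C a b d c := fun a b c d ↦ by rw [h₂, h₁, h₂]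
  have z : ∀ a c d, C a a c d = 0 := fun a c d ↦ by linarith [h₁ a a c d]
  have z' : ∀ a c d, C c d a a = 0 := fun a c d ↦ by rw [h₂, z]
  obtain ⟨s₁, s₂, s₃, s₄, s₅, s₆, α, β, μ, ν, ⟨c1, c2, c3, c4, c5, c6⟩, ⟨c7, c8, c9, c10, c11⟩,
    ⟨c12, c13, c14, c15⟩, ⟨c16, c17, c18⟩, ⟨c19, c20⟩, c21⟩ := weyl_components q C hq h₁ h₂ h₃ h₄
  -- These put the lexicographically smaller index pair in front, so that every component reduces to
  -- one of the 21 listed ones.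
  have p1 := h₂ 0 2 0 1
  have p2 := h₂ 0 3 0 1
  have p3 := h₂ 1 2 0 1
  have p4 := h₂ 1 3 0 1
  have p5 := h₂ 2 3 0 1
  have p6 := h₂ 0 3 0 2
  have p7 := h₂ 1 2 0 2
  have p8 := h₂ 1 3 0 2
  have p9 := h₂ 2 3 0 2
  have p10 := h₂ 1 2 0 3
  have p11 := h₂ 1 3 0 3
  have p12 := h₂ 2 3 0 3
  have p13 := h₂ 1 3 1 2
  have p14 := h₂ 2 3 1 2
  have p15 := h₂ 2 3 1 3
  set Q : Fin 4 → Fin 4 → ℝ := fun i j ↦ ∑ a, ∑ b, ∑ c, q a * q b * q c * (C i a b c * C j a b c)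
    with hQ
  have hsymm : ∀ i j, Q i j = Q j i := fun i j ↦ by simp only [hQ, mul_comm (C i _ _ _)]
  -- With `hoff` this shows that `Q` is a multiple of the metric; equality of the four weighted
  -- diagonal entries accounts for the factor 4.
  have hdiag : ∀ i, q i * Q i i = q 0 * Q 0 0 := by
    intro i
    simp only [hQ, Fin.sum_univ_four]
    fin_cases i
    · rfl
    all_goals
      simp only [Fin.mk_one, Fin.reduceFinMk, z, z', h₁ 1 0, h₁ 2 0, h₁ 3 0, h₁ 2 1, h₁ 3 1, h₁ 3 2,
        h₅ _ _ 1 0, h₅ _ _ 2 0, h₅ _ _ 3 0, h₅ _ _ 2 1, h₅ _ _ 3 1, h₅ _ _ 3 2, p1, p2, p3, p4, p5,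
        p6, p7, p8, p9, p10, p11, p12, p13, p14, p15, c1, c2, c3, c4, c5, c6, c7, c8, c9, c10, c11,
        c12, c13, c14, c15, c16, c17, c18, c19, c20, c21]
      ring
  have hoff : ∀ i j, i < j → Q i j = 0 := by
    intro i j hij
    simp only [hQ, Fin.sum_univ_four]
    fin_cases i <;> fin_cases j <;> first | exact absurd hij (by decide) | skip
    all_goals
      simp only [Fin.mk_one, Fin.reduceFinMk, Fin.zero_eta, z, z', h₁ 1 0, h₁ 2 0, h₁ 3 0, h₁ 2 1,
        h₁ 3 1, h₁ 3 2, h₅ _ _ 1 0, h₅ _ _ 2 0, h₅ _ _ 3 0, h₅ _ _ 2 1, h₅ _ _ 3 1, h₅ _ _ 3 2, p1,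
        p2, p3, p4, p5, p6, p7, p8, p9, p10, p11, p12, p13, p14, p15, c1, c2, c3, c4, c5, c6, c7,
        c8, c9, c10, c11, c12, c13, c14, c15, c16, c17, c18, c19, c20, c21]
      ring
  change 4 * (q i * Q i j) = if i = j then ∑ d, q d * Q d d else 0
  split_ifs with h
  · subst h
    simp [hdiag]
  · rcases lt_or_gt_of_ne h with h | h
    · rw [hoff i j h]; ring
    · rw [hsymm, hoff j i h]; ring

namespace PseudoRiemannianMetric

variable (g : PseudoRiemannianMetric M)

/-- A null vector in an orthogonal basis would be orthogonal to the whole space, against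
nondegeneracy. The basis is not normalised, so the signature plays no role. -/
theorem exists_orthogonal (x : M) : ∃ b : Module.Basis (Fin 4) ℝ (TangentSpace (𝓡 4) x),
    (∀ i j, i ≠ j → g.val x (b i) (b j) = 0) ∧ ∀ i, g.val x (b i) (b i) ≠ 0 := by
  have hfr : Module.finrank ℝ (TangentSpace (𝓡 4) x) = 4 :=
    (Module.finrank_eq_card_basis (frame x)).trans (by simp)
  obtain ⟨v, hv⟩ := LinearMap.BilinForm.exists_orthogonal_basis (B := g.bilin x)
    ⟨fun a b ↦ g.symm x a b⟩
  have hv' : ∀ i j, i ≠ j → g.val x (v i) (v j) = 0 := fun i j h ↦ hv h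
  refine ⟨v.reindex (finCongr hfr), fun i j h ↦ ?_, fun i h ↦ ?_⟩
  · simpa using hv' _ _ (by simpa using h)
  · have h0 : v.reindex (finCongr hfr) i = 0 := by
      refine g.nondegenerate x _ fun w ↦ ?_
      have : g.val x (v.reindex (finCongr hfr) i) = 0 := by
        apply ContinuousLinearMap.coe_injective
        refine (v.reindex (finCongr hfr)).ext fun j ↦ ?_
        by_cases hij : i = j
        · subst hij; simpa using h
        · simpa using hv' _ _ (by simpa using hij)
      rw [this]; rfl
    exact (v.reindex (finCongr hfr)).ne_zero i h0

/-- The contraction of two Weyl tensors in all but the first slots. -/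
def weylContr (x : M) (e f : Fin 4 → TangentSpace (𝓡 4) x) (u v : TangentSpace (𝓡 4) x) : ℝ :=
  ∑ a, ∑ m, ∑ p, g.weyl x u (e a) (e m) (e p) * g.weyl x v (f a) (f m) (f p)

variable {g} in
theorem DualPair.weylContr_eq {e f e' f' : Fin 4 → TangentSpace (𝓡 4) x} (h : g.DualPair x e f)
    (h' : g.DualPair x e' f') (u v : TangentSpace (𝓡 4) x) :
    g.weylContr x e f u v = g.weylContr x e' f' u v := by
  rw [weylContr, weylContr, h.contract_eq h'
    (B := fun y z ↦ ∑ m, ∑ p, g.weyl x u y (e m) (e p) * g.weyl x v z (f m) (f p))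
    (fun z ↦ .finsetSum fun _ _ ↦ .finsetSum fun _ _ ↦ (g.isLinearMap_weyl₂ x u _ _).mul_const _)
    (fun y ↦ .finsetSum fun _ _ ↦ .finsetSum fun _ _ ↦ (g.isLinearMap_weyl₂ x v _ _).const_mul _)]
  refine Finset.sum_congr rfl fun a _ ↦ ?_
  rw [h.contract_eq h'
    (B := fun y z ↦ ∑ p, g.weyl x u (e' a) y (e p) * g.weyl x v (f' a) z (f p))
    (fun z ↦ .finsetSum fun _ _ ↦ (g.isLinearMap_weyl₃ x u _ _).mul_const _)
    (fun y ↦ .finsetSum fun _ _ ↦ (g.isLinearMap_weyl₃ x v _ _).const_mul _)]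
  refine Finset.sum_congr rfl fun m _ ↦ ?_
  exact h.contract_eq h'
    (B := fun y z ↦ g.weyl x u (e' a) (e' m) y * g.weyl x v (f' a) (f' m) z)
    (fun z ↦ (g.isLinearMap_weyl₄ x u _ _).mul_const _)
    (fun y ↦ (g.isLinearMap_weyl₄ x v _ _).const_mul _)

theorem isLinearMap_weylContr_left (x : M) (e f : Fin 4 → TangentSpace (𝓡 4) x)
    (v : TangentSpace (𝓡 4) x) : IsLinearMap ℝ (fun u ↦ g.weylContr x e f u v) :=
  .finsetSum fun _ _ ↦ .finsetSum fun _ _ ↦ .finsetSum fun _ _ ↦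
    (g.isLinearMap_weyl₁ x _ _ _).mul_const _

theorem isLinearMap_weylContr_right (x : M) (e f : Fin 4 → TangentSpace (𝓡 4) x)
    (u : TangentSpace (𝓡 4) x) : IsLinearMap ℝ (fun v ↦ g.weylContr x e f u v) :=
  .finsetSum fun _ _ ↦ .finsetSum fun _ _ ↦ .finsetSum fun _ _ ↦
    (g.isLinearMap_weyl₁ x _ _ _).const_mul _

variable {g} in
theorem DualPair.weylSq_eq {e f : Fin 4 → TangentSpace (𝓡 4) x} (h : g.DualPair x e f) :
    g.weylSq x = ∑ d, g.weylContr x e f (e d) (f d) := by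
  rw [h.contract_eq (g.dualPair_ptl_up x) (g.isLinearMap_weylContr_left x e f)
    (g.isLinearMap_weylContr_right x e f)]
  exact Finset.sum_congr rfl fun d _ ↦ (g.dualPair_ptl_up x).weylContr_eq h _ _

variable {g} in
/-- In dimension four, `4 C_d^{amp} C_{eamp} = (C · C) g_{de}`. -/
theorem DualPair.four_mul_weylContr {e f : Fin 4 → TangentSpace (𝓡 4) x} (h : g.DualPair x e f)
    (u v : TangentSpace (𝓡 4) x) : 4 * g.weylContr x e f u v = g.weylSq x * g.val x u v := by
  obtain ⟨b, hb, hb0⟩ := g.exists_orthogonal x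
  set q : Fin 4 → ℝ := fun i ↦ (g.val x (b i) (b i))⁻¹ with hq
  -- The dual of an orthogonal basis is a rescaling of it, so contractions become sums weighted by
  -- the `q i`.
  have hbq : g.DualPair x b (fun i ↦ q i • b i) := by
    intro w
    refine g.ext_val fun z ↦ ?_
    have : g.val x (∑ a, g.val x (b a) w • q a • b a) = g.val x w := by
      apply ContinuousLinearMap.coe_injective
      refine b.ext fun j ↦ ?_
      simp only [map_sum, map_smul, ContinuousLinearMap.coe_coe, _root_.sum_apply,
        _root_.smul_apply, smul_eq_mul]
      rw [Finset.sum_eq_single j]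
      · rw [g.symm x (b j) w]
        simp only [hq]
        field_simp [hb0 j]
      · intro i _ hij
        rw [hb i j hij]; ring
      · simp
    rw [this]
  have hlin : ∀ (c₁ c₂ c₃ : ℝ) (u v w z : TangentSpace (𝓡 4) x),
      g.weyl x u (c₁ • v) (c₂ • w) (c₃ • z) = c₁ * c₂ * c₃ * g.weyl x u v w z := by
    intro c₁ c₂ c₃ u v w z
    rw [(g.isLinearMap_weyl₂ x u _ _).map_smul, (g.isLinearMap_weyl₃ x u _ _).map_smul,
      (g.isLinearMap_weyl₄ x u _ _).map_smul]
    simp only [smul_eq_mul]; ring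
  have hT : ∀ u v, g.weylContr x b (fun i ↦ q i • b i) u v = ∑ a, ∑ m, ∑ p, q a * q m * q p *
      (g.weyl x u (b a) (b m) (b p) * g.weyl x v (b a) (b m) (b p)) := by
    intro u v
    refine Finset.sum_congr rfl fun a _ ↦ Finset.sum_congr rfl fun m _ ↦
      Finset.sum_congr rfl fun p _ ↦ ?_
    rw [hlin]; ring
  have key := weyl_contraction_orthogonal q (fun i j k l ↦ g.weyl x (b i) (b j) (b k) (b l))
    (fun i ↦ inv_ne_zero (hb0 i)) (fun _ _ _ _ ↦ g.weyl_swap x _ _ _ _)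
    (fun _ _ _ _ ↦ g.weyl_pair x _ _ _ _) (fun _ _ _ _ ↦ g.weyl_bianchi x _ _ _ _)
    (fun a c ↦ by
      rw [← hbq.sum_weyl (b a) (b c)]
      exact Finset.sum_congr rfl fun i _ ↦ ((g.isLinearMap_weyl₄ x _ _ _).map_smul _ _).symm)
  have hsq : g.weylSq x = ∑ d, q d * g.weylContr x b (fun i ↦ q i • b i) (b d) (b d) := by
    rw [hbq.weylSq_eq]
    exact Finset.sum_congr rfl fun d _ ↦ (g.isLinearMap_weylContr_right x _ _ _).map_smul _ _
  simp only [← hT, ← hsq] at key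
  rw [h.weylContr_eq hbq]
  set T := g.weylContr x b (fun i ↦ q i • b i)
  have hij : ∀ i j, 4 * T (b i) (b j) = g.weylSq x * g.val x (b i) (b j) := by
    intro i j
    have hk := key i j
    split_ifs at hk with hij
    · subst hij
      rw [← hk]
      simp only [hq]
      field_simp [hb0 i]
    · rw [hb i j hij]
      have := (mul_eq_zero.1 ((mul_eq_zero.1 hk).resolve_left (by norm_num))).resolve_left
        (inv_ne_zero (hb0 i))
      rw [this]; ring
  have h1 : ∀ j, 4 * T u (b j) = g.weylSq x * g.val x u (b j) := fun j ↦
    LinearMap.congr_fun (b.ext (fun i ↦ hij i j) :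
      IsLinearMap.mk' _ ((g.isLinearMap_weylContr_left x _ _ (b j)).const_mul 4)
        = IsLinearMap.mk' _ ((g.isLinearMap_val_left x (b j)).const_mul (g.weylSq x))) u
  exact LinearMap.congr_fun (b.ext h1 :
      IsLinearMap.mk' _ ((g.isLinearMap_weylContr_right x _ _ u).const_mul 4)
        = IsLinearMap.mk' _ ((g.isLinearMap_val_right x u).const_mul (g.weylSq x))) v

end PseudoRiemannianMetric

/-! ### Conformal change of the connection and of the curvature. -/

theorem mvfderiv_exp {υ : M → ℝ} (hυ : MDifferentiableAt (𝓡 4) 𝓘(ℝ) υ x)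
    (v : TangentSpace (𝓡 4) x) :
    mvfderiv (𝓡 4) (fun y ↦ Real.exp (2 * υ y)) x v
      = 2 * Real.exp (2 * υ x) * mvfderiv (𝓡 4) υ x v := by
  have hd : HasDerivAt (fun t : ℝ ↦ Real.exp (2 * t)) (Real.exp (2 * υ x) * 2) (υ x) := by
    simpa using ((hasDerivAt_id (υ x)).const_mul 2).exp
  have := mvfderiv_comp_apply (I' := 𝓡 4) (I := 𝓘(ℝ)) (g := fun t : ℝ ↦ Real.exp (2 * t)) x
    hd.differentiableAt.mdifferentiableAt hυ v
  change mvfderiv (𝓡 4) ((fun t : ℝ ↦ Real.exp (2 * t)) ∘ υ) x v = _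
  rw [this]
  simp only [mvfderiv, mfderiv_eq_fderiv]
  have aux : ∀ m : ℝ, fderiv ℝ (fun t : ℝ ↦ Real.exp (2 * t)) (υ x) m
      = 2 * Real.exp (2 * υ x) * m := fun m ↦ by
    rw [hd.hasFDerivAt.fderiv]
    simp
    ring
  exact aux _

namespace PseudoRiemannianMetric

variable (g : PseudoRiemannianMetric M)

/-- The gradient of the function `υ`. -/
def grad (υ : M → ℝ) (x : M) : TangentSpace (𝓡 4) x := g.sharp x (mvfderiv (𝓡 4) υ x).toLinearMap

theorem val_grad (υ : M → ℝ) (x : M) (v : TangentSpace (𝓡 4) x) :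
    g.val x (g.grad υ x) v = mvfderiv (𝓡 4) υ x v := g.val_sharp x _ v

theorem smoothVF_grad {υ : M → ℝ} (hU : IsOpen U) (hυ : SmoothFun U υ) :
    SmoothVF U (g.grad υ) := by
  intro x hx
  have hV : IsOpen (U ∩ dom x) := hU.inter (isOpen_dom x)
  have h : SmoothVF (U ∩ dom x) (g.grad υ) := by
    refine g.smoothVF_of_val Set.inter_subset_right fun i ↦ ?_
    simp only [val_grad]
    exact (hυ.mono Set.inter_subset_left).lie hV ((smoothVF_loc x i).mono Set.inter_subset_right)
  exact (h.contMDiffAt (hV.mem_nhds ⟨hx, mem_dom x⟩)).contMDiffWithinAt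

/-- The Hessian is symmetric. -/
theorem hess_symm {υ : M → ℝ} (hυ : SmoothFun Set.univ υ) (x : M) (u v : TangentSpace (𝓡 4) x) :
    g.val x (g.leviCivita (g.grad υ) x u) v = g.val x (g.leviCivita (g.grad υ) x v) u := by
  have hU := isOpen_dom x
  have hx := mem_dom x
  have hN := (g.smoothVF_grad isOpen_univ hυ).diffAt isOpen_univ (Set.mem_univ x)
  have hu := (smoothVF_extendVec u).diffAt hU hx
  have hv := (smoothVF_extendVec v).diffAt hU hx
  have h1 := g.lie_val hu hN hv
  have h2 := g.lie_val hv hN hu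
  -- The commutator of the derivatives of `υ` is `dυ([u, v])`, which vanishing torsion matches with
  -- the connection terms.
  have h3 : lie (extendVec u) (fun y ↦ mvfderiv (𝓡 4) υ y (extendVec v y)) x
      - lie (extendVec v) (fun y ↦ mvfderiv (𝓡 4) υ y (extendVec u y)) x
      = mvfderiv (𝓡 4) υ x (mlieBracket (𝓡 4) (extendVec u) (extendVec v) x) :=
    lie_comm hU (smoothVF_extendVec u) (smoothVF_extendVec v) (hυ.mono (Set.subset_univ _)) hx
  rw [← g.nabla_sub_nabla hu hv] at h3
  simp only [val_grad, lie, nabla, extendVec_self, map_sub] at h1 h2 h3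
  linarith

theorem nabla_sub (hX : DiffAt X x) (hY : DiffAt Y x) :
    g.leviCivita (X - Y) x = g.leviCivita X x - g.leviCivita Y x := by
  have h : DiffAt (X - Y) x := mdifferentiableAt_sub_section hX hY
  have := g.nabla_add h hY
  rw [sub_add_cancel] at this
  rw [this]; abel

variable {g} {g' : PseudoRiemannianMetric M} {υ : M → ℝ} (hυ : SmoothFun Set.univ υ)
  (hg : ∀ (x : M) (v w : TangentSpace (𝓡 4) x),
    g'.val x v w = Real.exp (2 * υ x) * g.val x v w)

include hυ hg in
/-- The Levi-Civita connection of a conformally related metric. -/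
theorem leviCivita_conformal (hY : DiffAt Y x) (v : TangentSpace (𝓡 4) x) :
    g'.leviCivita Y x v = g.leviCivita Y x v + g.val x (g.grad υ x) v • Y x
      + g.val x (g.grad υ x) (Y x) • v - g.val x v (Y x) • g.grad υ x := by
  refine g'.ext_val fun z ↦ ?_
  have hU := isOpen_dom x
  have hx := mem_dom x
  have hυx := hυ.mdiffAt isOpen_univ (Set.mem_univ x)
  have hv := (smoothVF_extendVec v).diffAt hU hx
  have hz := (smoothVF_extendVec z).diffAt hU hx
  have hφ : MDifferentiableAt (𝓡 4) 𝓘(ℝ) (fun y ↦ Real.exp (2 * υ y)) x := by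
    have : DifferentiableAt ℝ (fun t : ℝ ↦ Real.exp (2 * t)) (υ x) := by fun_prop
    exact this.mdifferentiableAt.comp x hυx
  -- In the Koszul formula for `g'` the bracket terms only rescale; `dυ` enters through the three
  -- derivative terms.
  have key : ∀ {A B : Π y : M, TangentSpace (𝓡 4) y}, DiffAt A x → DiffAt B x →
      ∀ c : TangentSpace (𝓡 4) x, mvfderiv (𝓡 4) (fun y ↦ g'.val y (A y) (B y)) x c
        = Real.exp (2 * υ x) * (mvfderiv (𝓡 4) (fun y ↦ g.val y (A y) (B y)) x c
          + 2 * g.val x (g.grad υ x) c * g.val x (A x) (B x)) := by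
    intro A B hA hB c
    simp only [hg]
    rw [mvfderiv_fun_mul hφ (g.mdifferentiableAt_val hA hB)]
    simp only [_root_.add_apply, _root_.smul_apply, smul_eq_mul, mvfderiv_exp hυx, val_grad]
    ring
  have h1 := g.val_leviCivita hv hY hz
  have h2 := g'.val_leviCivita hv hY hz
  simp only [koszul, key hY hz, key hv hz, key hv hY, extendVec_self] at h1 h2
  simp only [hg] at h2
  simp only [hg, map_add, map_sub, map_smul, _root_.add_apply, _root_.sub_apply,
    _root_.smul_apply, smul_eq_mul]
  rw [g.symm x v (Y x)] at *
  linear_combination (1 / 2) * h2 - (1 / 2) * Real.exp (2 * υ x) * h1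

/-- The change of the Schouten tensor under a conformal change of the metric. -/
def schoutenChange (g : PseudoRiemannianMetric M) (υ : M → ℝ) (x : M)
    (u v : TangentSpace (𝓡 4) x) : ℝ :=
  -g.val x (g.leviCivita (g.grad υ) x u) v + g.val x (g.grad υ x) u * g.val x (g.grad υ x) v
    - 1 / 2 * g.val x (g.grad υ x) (g.grad υ x) * g.val x u v

include hυ in
theorem schoutenChange_symm (u v : TangentSpace (𝓡 4) x) :
    g.schoutenChange υ x u v = g.schoutenChange υ x v u := by
  rw [schoutenChange, schoutenChange, g.hess_symm hυ, g.symm x u v]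
  ring

-- The formula for `∇'` is applied twice and antisymmetrised. Symmetry of the Hessian lets the
-- derivatives of `dυ` assemble with the quadratic terms into `schoutenChange`.
set_option maxHeartbeats 2000000 in
include hυ hg in
theorem curv_conformal (hU : IsOpen U) (hX : SmoothVF U X) (hY : SmoothVF U Y)
    (hZ : SmoothVF U Z) (hx : x ∈ U) (w : TangentSpace (𝓡 4) x) :
    g.val x (g'.curv X Y Z x) w = g.val x (g.curv X Y Z x) w
      + (g.schoutenChange υ x w (Y x) * g.val x (X x) (Z x)
        - g.schoutenChange υ x w (X x) * g.val x (Y x) (Z x))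
      + (g.val x (Y x) w * g.schoutenChange υ x (X x) (Z x)
        - g.val x (X x) w * g.schoutenChange υ x (Y x) (Z x)) := by
  have hN : SmoothVF U (g.grad υ) := g.smoothVF_grad hU (hυ.mono (Set.subset_univ _))
  have second : ∀ {A B : Π y : M, TangentSpace (𝓡 4) y}, SmoothVF U A → SmoothVF U B →
      g'.leviCivita (g'.nabla B Z) x (A x)
        = g.leviCivita (g.nabla B Z) x (A x) + g.val x (g.grad υ x) (B x) • g.nabla A Z x
          + (g.val x (g.nabla A (g.grad υ) x) (B x)
            + g.val x (g.grad υ x) (g.nabla A B x)) • Z x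
          + g.val x (g.grad υ x) (Z x) • g.nabla A B x
          + (g.val x (g.nabla A (g.grad υ) x) (Z x)
            + g.val x (g.grad υ x) (g.nabla A Z x)) • B x
          - g.val x (B x) (Z x) • g.nabla A (g.grad υ) x
          - (g.val x (g.nabla A B x) (Z x) + g.val x (B x) (g.nabla A Z x)) • g.grad υ x
          + g.val x (g.grad υ x) (A x) • g'.nabla B Z x
          + g.val x (g.grad υ x) (g'.nabla B Z x) • A x
          - g.val x (A x) (g'.nabla B Z x) • g.grad υ x := by
    intro A B hA hB
    have d := fun {V : Π y : M, TangentSpace (𝓡 4) y} (hV : SmoothVF U V) ↦ hV.diffAt hU hx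
    have hBZ := g.smoothVF_nabla hU hB hZ
    have f1 := g.smoothFun_val hN hB
    have f2 := g.smoothFun_val hN hZ
    have f3 := g.smoothFun_val hB hZ
    have s1 := hZ.smul f1
    have s2 := hB.smul f2
    have s3 := hN.smul f3
    set V := g.nabla B Z + (fun y ↦ g.val y (g.grad υ y) (B y)) • Z
      + (fun y ↦ g.val y (g.grad υ y) (Z y)) • B - (fun y ↦ g.val y (B y) (Z y)) • g.grad υ
      with hVdef
    have hV : SmoothVF U V := ((hBZ.add s1).add s2).sub s3
    have hVeq : Set.EqOn (g'.nabla B Z) V U := fun y hy ↦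
      leviCivita_conformal hυ hg (hZ.diffAt hU hy) (B y)
    rw [g'.nabla_congr hU hx (d (g'.smoothVF_nabla hU hB hZ)) (d hV) hVeq,
      leviCivita_conformal hυ hg (d hV) (A x), hVeq hx]
    have e : g.leviCivita V x (A x) = g.leviCivita (g.nabla B Z) x (A x)
          + g.val x (g.grad υ x) (B x) • g.nabla A Z x
          + (g.val x (g.nabla A (g.grad υ) x) (B x)
            + g.val x (g.grad υ x) (g.nabla A B x)) • Z x
          + g.val x (g.grad υ x) (Z x) • g.nabla A B x
          + (g.val x (g.nabla A (g.grad υ) x) (Z x)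
            + g.val x (g.grad υ x) (g.nabla A Z x)) • B x
          - g.val x (B x) (Z x) • g.nabla A (g.grad υ) x
          - (g.val x (g.nabla A B x) (Z x) + g.val x (B x) (g.nabla A Z x)) • g.grad υ x := by
      rw [hVdef, g.nabla_sub (d ((hBZ.add s1).add s2)) (d s3), g.nabla_add (d (hBZ.add s1)) (d s2),
        g.nabla_add (d hBZ) (d s1), g.nabla_smul (f1.mdiffAt hU hx) (d hZ),
        g.nabla_smul (f2.mdiffAt hU hx) (d hB), g.nabla_smul (f3.mdiffAt hU hx) (d hN),
        ← g.lie_val (d hA) (d hN) (d hB), ← g.lie_val (d hA) (d hN) (d hZ),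
        ← g.lie_val (d hA) (d hB) (d hZ)]
      simp only [_root_.add_apply, _root_.sub_apply, _root_.smul_apply,
        ContinuousLinearMap.smulRight_apply]
      abel
    rw [e]
  have b := g.nabla_sub_nabla (hX.diffAt hU hx) (hY.diffAt hU hx)
  have d := fun {V : Π y : M, TangentSpace (𝓡 4) y} (hV : SmoothVF U V) ↦ hV.diffAt hU hx
  simp only [curv]
  rw [second hX hY, second hY hX]
  simp only [nabla]
  rw [leviCivita_conformal hυ hg (d hZ) (X x), leviCivita_conformal hυ hg (d hZ) (Y x),
    leviCivita_conformal hυ hg (d hZ) (mlieBracket (𝓡 4) X Y x), ← b]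
  simp only [nabla, schoutenChange, map_add, map_sub, map_smul, map_neg, _root_.add_apply,
    _root_.sub_apply, _root_.smul_apply, _root_.neg_apply, smul_eq_mul]
  rw [g.hess_symm hυ x w (Y x), g.hess_symm hυ x w (X x), g.symm x w (X x), g.symm x w (Y x),
    g.hess_symm hυ x (Y x) (X x), g.symm x (Y x) (X x), g.symm x (X x) (g.grad υ x),
    g.symm x (Y x) (g.grad υ x), g.symm x (X x) (g.leviCivita Z x (Y x)),
    g.symm x (Y x) (g.leviCivita Z x (X x))]
  ring

theorem isLinearMap_schoutenChange_left (g : PseudoRiemannianMetric M) (υ : M → ℝ) (x : M)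
    (v : TangentSpace (𝓡 4) x) : IsLinearMap ℝ (fun u ↦ g.schoutenChange υ x u v) where
  map_add a b := by
    simp only [schoutenChange, map_add, _root_.add_apply]; ring
  map_smul c a := by
    simp only [schoutenChange, map_smul, _root_.smul_apply, smul_eq_mul]; ring

include hυ hg in
theorem rm_conformal (x : M) (u v w z : TangentSpace (𝓡 4) x) :
    g'.rm x u v w z = Real.exp (2 * υ x) * (g.rm x u v w z
      + (g.schoutenChange υ x z v * g.val x u w - g.schoutenChange υ x z u * g.val x v w)
      + (g.val x v z * g.schoutenChange υ x u w - g.val x u z * g.schoutenChange υ x v w)) := by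
  have := curv_conformal hυ hg (isOpen_dom x) (smoothVF_extendVec u) (smoothVF_extendVec v)
    (smoothVF_extendVec w) (mem_dom x) z
  simp only [extendVec_self, ← riemann_eq_curv] at this
  rw [rm, hg, this, rm]

include hg in
theorem up_conformal (x : M) (a : Fin 4) :
    g'.up x a = (Real.exp (2 * υ x))⁻¹ • g.up x a := by
  refine g'.ext_val fun z ↦ ?_
  rw [val_up, hg, map_smul, _root_.smul_apply, val_up, smul_eq_mul,
    mul_inv_cancel_left₀ (Real.exp_ne_zero _)]

-- Tracing the change `P` of the curvature in dimension `n` gives `(n - 2) P + (tr P) g`; here `n =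
-- 4`.
include hυ hg in
theorem ric_conformal (x : M) (u w : TangentSpace (𝓡 4) x) :
    g'.ric x u w = g.ric x u w + 2 * g.schoutenChange υ x u w
      + (∑ a, g.schoutenChange υ x (ptl x a) (g.up x a)) * g.val x u w := by
  have hd := g.dualPair_ptl_up x
  have h1 := hd.sum_mul (g.isLinearMap_schoutenChange_left υ x u) w
  have h2 : ∑ a, g.val x u (g.up x a) * g.schoutenChange υ x (ptl x a) w
      = g.schoutenChange υ x u w := by
    simp only [g.symm x u]
    exact hd.swap.sum_mul (g.isLinearMap_schoutenChange_left υ x w) u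
  have h3 := hd.sum_val
  rw [(g'.dualPair_ptl_up x).ric_eq, hd.ric_eq]
  simp only [up_conformal hg, (g'.isLinearMap_rm₄ x _ _ _).map_smul, rm_conformal hυ hg,
    smul_eq_mul, inv_mul_cancel_left₀ (Real.exp_ne_zero _)]
  simp only [Finset.sum_add_distrib, Finset.sum_sub_distrib, ← Finset.sum_mul, h2, h3,
    fun a ↦ mul_comm (g.schoutenChange υ x (g.up x a) u), h1]
  rw [schoutenChange_symm hυ w u]
  have h4 : ∑ a, g.schoutenChange υ x (g.up x a) (ptl x a)
      = ∑ a, g.schoutenChange υ x (ptl x a) (g.up x a) :=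
    Finset.sum_congr rfl fun a _ ↦ schoutenChange_symm hυ _ _
  rw [h4]
  ring

include hυ hg in
theorem scalarCurv_conformal (x : M) : g'.scalarCurv x = (Real.exp (2 * υ x))⁻¹ *
    (g.scalarCurv x + 6 * ∑ a, g.schoutenChange υ x (ptl x a) (g.up x a)) := by
  have h3 := (g.dualPair_ptl_up x).sum_val
  rw [(g'.dualPair_ptl_up x).scalarCurv_eq, (g.dualPair_ptl_up x).scalarCurv_eq]
  simp only [up_conformal hg, (g'.isLinearMap_ric_right x _).map_smul, smul_eq_mul,
    ← Finset.mul_sum, ric_conformal hυ hg, Finset.sum_add_distrib, h3]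
  ring

-- The Schouten normalisation inverts `P ↦ 2 P + (tr P) g`, so the change is exactly `P`.
include hυ hg in
theorem schouten_conformal (x : M) (u w : TangentSpace (𝓡 4) x) :
    g'.schouten x u w = g.schouten x u w + g.schoutenChange υ x u w := by
  have h := ric_conformal hυ hg x u w
  rw [ric, ric] at h
  rw [schouten, schouten, h, scalarCurv_conformal hυ hg, hg]
  field_simp [Real.exp_ne_zero (2 * υ x)]
  ring

-- The term acquired by the Riemann tensor is built from the change of `L` just as the terms
-- subtracted in the Weyl tensor are built from `L`; the two cancel.
include hυ hg in
theorem weyl_conformal (x : M) (u v w z : TangentSpace (𝓡 4) x) :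
    g'.weyl x u v w z = Real.exp (2 * υ x) * g.weyl x u v w z := by
  simp only [weyl_eq, rm_conformal hυ hg, schouten_conformal hυ hg, hg]
  ring

include hυ hg in
theorem weyl_up_conformal (x : M) (u : TangentSpace (𝓡 4) x) (a m p : Fin 4) :
    g'.weyl x u (g'.up x a) (g'.up x m) (g'.up x p)
      = (Real.exp (2 * υ x))⁻¹ ^ 2 * g.weyl x u (g.up x a) (g.up x m) (g.up x p) := by
  rw [weyl_conformal hυ hg, up_conformal hg, up_conformal hg, up_conformal hg,
    (g.isLinearMap_weyl₂ x _ _ _).map_smul, (g.isLinearMap_weyl₃ x _ _ _).map_smul,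
    (g.isLinearMap_weyl₄ x _ _ _).map_smul]
  simp only [smul_eq_mul]
  field_simp [Real.exp_ne_zero (2 * υ x)]

include hυ hg in
theorem weylSq_conformal (x : M) :
    g'.weylSq x = (Real.exp (2 * υ x))⁻¹ ^ 2 * g.weylSq x := by
  simp only [weylSq, weyl_up_conformal hυ hg, Finset.mul_sum]
  refine Finset.sum_congr rfl fun a _ ↦ Finset.sum_congr rfl fun b _ ↦
    Finset.sum_congr rfl fun c _ ↦ Finset.sum_congr rfl fun d _ ↦ ?_
  rw [weyl_conformal hυ hg, up_conformal hg x a, (g.isLinearMap_weyl₁ x _ _ _).map_smul, smul_eq_mul]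
  field_simp [Real.exp_ne_zero (2 * υ x)]

/-- The covariant derivative of the change of the Schouten tensor. -/
theorem lie_schoutenChange (hU : IsOpen U) (hx : x ∈ U) (hυ : SmoothFun Set.univ υ)
    (hX : SmoothVF U X) (hY : SmoothVF U Y) (hZ : SmoothVF U Z) :
    lie X (fun y ↦ g.schoutenChange υ y (Y y) (Z y)) x
      = -(g.val x (g.nabla X (g.nabla Y (g.grad υ)) x) (Z x)
          + g.val x (g.nabla Y (g.grad υ) x) (g.nabla X Z x))
        + ((g.val x (g.nabla X (g.grad υ) x) (Y x) + g.val x (g.grad υ x) (g.nabla X Y x))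
            * g.val x (g.grad υ x) (Z x)
          + g.val x (g.grad υ x) (Y x)
            * (g.val x (g.nabla X (g.grad υ) x) (Z x) + g.val x (g.grad υ x) (g.nabla X Z x)))
        - (g.val x (g.nabla X (g.grad υ) x) (g.grad υ x) * g.val x (Y x) (Z x)
          + 1 / 2 * g.val x (g.grad υ x) (g.grad υ x)
            * (g.val x (g.nabla X Y x) (Z x) + g.val x (Y x) (g.nabla X Z x))) := by
  have hN : SmoothVF U (g.grad υ) := g.smoothVF_grad hU (hυ.mono (Set.subset_univ _))
  have d := fun {V : Π y : M, TangentSpace (𝓡 4) y} (hV : SmoothVF U V) ↦ hV.diffAt hU hx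
  have m := fun {F : M → ℝ} (hF : SmoothFun U F) ↦ hF.mdiffAt hU hx
  have hH := g.smoothFun_val (g.smoothVF_nabla hU hY hN) hZ
  have f1 := g.smoothFun_val hN hY
  have f2 := g.smoothFun_val hN hZ
  have f3 := g.smoothFun_val hN hN
  have f4 := g.smoothFun_val hY hZ
  have f5 := (SmoothFun.const (U := U) (1 / 2)).mul f3
  have e1 := g.lie_val (d hX) (d (g.smoothVF_nabla hU hY hN)) (d hZ)
  have e2 := g.lie_val (d hX) (d hN) (d hY)
  have e3 := g.lie_val (d hX) (d hN) (d hZ)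
  have e4 := g.lie_val (d hX) (d hN) (d hN)
  have e5 := g.lie_val (d hX) (d hY) (d hZ)
  have hP : (fun y ↦ g.schoutenChange υ y (Y y) (Z y)) = fun y ↦
      (g.val y (g.grad υ y) (Y y) * g.val y (g.grad υ y) (Z y)
        - g.val y (g.nabla Y (g.grad υ) y) (Z y))
        - 1 / 2 * g.val y (g.grad υ y) (g.grad υ y) * g.val y (Y y) (Z y) := by
    funext y
    simp only [schoutenChange, nabla]
    ring
  simp only [lie] at *
  rw [hP, mvfderiv_fun_sub (m ((f1.mul f2).sub hH)) (m (f5.mul f4)),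
    mvfderiv_fun_sub (m (f1.mul f2)) (m hH), mvfderiv_fun_mul (m f1) (m f2),
    mvfderiv_fun_mul (m f5) (m f4),
    mvfderiv_fun_mul (m (SmoothFun.const (U := U) (1 / 2))) (m f3)]
  simp only [_root_.add_apply, _root_.sub_apply, _root_.smul_apply, smul_eq_mul, e1, e2, e3, e4, e5,
    g.symm x (g.grad υ x) (g.nabla X (g.grad υ) x), mvfderiv_const, _root_.zero_apply]
  ring

set_option maxHeartbeats 2000000 in
include hυ hg in
/-- The change of the Cotton tensor under a conformal change of the metric. -/
theorem cotton_conformal (x : M) (m p a : TangentSpace (𝓡 4) x) :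
    g'.covSchouten x m p a - g'.covSchouten x p m a
      = g.covSchouten x m p a - g.covSchouten x p m a + g.weyl x (g.grad υ x) a m p := by
  have hU := isOpen_dom x
  have hx := mem_dom x
  have d := fun v : TangentSpace (𝓡 4) x ↦ (smoothVF_extendVec v).diffAt hU hx
  have hN : SmoothVF (dom x) (g.grad υ) := g.smoothVF_grad hU (hυ.mono (Set.subset_univ _))
  -- `schoutenChange` is the difference of two Schouten tensors and inherits their
  -- differentiability.
  have hsm : ∀ u v : TangentSpace (𝓡 4) x, MDifferentiableAt (𝓡 4) 𝓘(ℝ)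
      (fun y ↦ g.schoutenChange υ y (extendVec u y) (extendVec v y)) x := fun u v ↦ by
    have := (g'.mdiffAt_schouten (d u) (d v)).sub (g.mdiffAt_schouten (d u) (d v))
    refine this.congr_of_eventuallyEq (Filter.Eventually.of_forall fun y ↦ ?_)
    simp [schouten_conformal hυ hg]
  have cov : ∀ m p : TangentSpace (𝓡 4) x, g'.covSchouten x m p a
      = mvfderiv (𝓡 4) (fun y ↦ g.schouten y (extendVec p y) (extendVec a y)) x m
        + lie (extendVec m) (fun y ↦ g.schoutenChange υ y (extendVec p y) (extendVec a y)) x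
        - g'.schouten x (g'.leviCivita (extendVec p) x m) a
        - g'.schouten x p (g'.leviCivita (extendVec a) x m) := fun m p ↦ by
    have : (fun y ↦ g'.schouten y (extendVec p y) (extendVec a y))
        = fun y ↦ g.schouten y (extendVec p y) (extendVec a y)
          + g.schoutenChange υ y (extendVec p y) (extendVec a y) :=
      funext fun y ↦ schouten_conformal hυ hg y _ _
    rw [covSchouten, this, mvfderiv_fun_add (g.mdiffAt_schouten (d p) (d a)) (hsm p a),
      _root_.add_apply, lie, extendVec_self]
  have hcurv := g.curv_eq_riemann hU (smoothVF_extendVec m) (smoothVF_extendVec p) hN hx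
  -- The antisymmetrised second derivatives of `grad υ` form the curvature applied to it; the
  -- Schouten terms from the change of connection complete this to the Weyl tensor.
  have hrm : g.rm x m p (g.grad υ x) a
      = g.val x (g.curv (extendVec m) (extendVec p) (g.grad υ) x) a := by
    rw [hcurv, extendVec_self, extendVec_self, rm]
  have hb := g.nabla_sub_nabla (d m) (d p)
  rw [curv, ← hb] at hrm
  have lS := fun v ↦ g.isLinearMap_schouten_left x v
  have rS := fun v ↦ g.isLinearMap_schouten_right x v
  rw [cov, cov, lie_schoutenChange hU hx hυ (smoothVF_extendVec m) (smoothVF_extendVec p)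
    (smoothVF_extendVec a), lie_schoutenChange hU hx hυ (smoothVF_extendVec p)
    (smoothVF_extendVec m) (smoothVF_extendVec a), g.weyl_pair, weyl_eq]
  simp only [leviCivita_conformal hυ hg (d _), schouten_conformal hυ hg, covSchouten,
    extendVec_self, nabla, hrm, schoutenChange, map_add, map_sub, map_neg, map_smul,
    _root_.add_apply, _root_.sub_apply, _root_.neg_apply, _root_.smul_apply,
    (lS _).map_add, (lS _).map_sub, (lS _).map_smul, (rS _).map_add, (rS _).map_sub,
    (rS _).map_smul, smul_eq_mul]
  rw [g.schouten_symm x p m, g.hess_symm hυ x p m, g.symm x p m, g.schouten_symm x a p,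
    g.schouten_symm x a m, g.symm x p (g.grad υ x), g.symm x m (g.grad υ x)]
  ring

end PseudoRiemannianMetric

/-! ### The one-form `Λ` and the `𝓒`-connection. -/

namespace PseudoRiemannianMetric

variable (g : PseudoRiemannianMetric M)

/-- The contraction `C_d^{amp} ∇_{[m} L_{p]a}` of the Weyl tensor with the Cotton tensor. -/
def weylCotton (x : M) (e f : Fin 4 → TangentSpace (𝓡 4) x) (u : TangentSpace (𝓡 4) x) : ℝ :=
  ∑ a, ∑ m, ∑ p, g.weyl x u (e a) (e m) (e p)
    * (1 / 2 * (g.covSchouten x (f m) (f p) (f a) - g.covSchouten x (f p) (f m) (f a)))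

variable {g} in
theorem DualPair.weylCotton_eq {e f e' f' : Fin 4 → TangentSpace (𝓡 4) x} (h : g.DualPair x e f)
    (h' : g.DualPair x e' f') (u : TangentSpace (𝓡 4) x) :
    g.weylCotton x e f u = g.weylCotton x e' f' u := by
  have l₁ := g.isLinearMap_covSchouten₁ x
  have l₂ := g.isLinearMap_covSchouten₂ x
  have l₃ := g.isLinearMap_covSchouten₃ x
  rw [weylCotton, weylCotton, h.contract_eq h'
    (B := fun y z ↦ ∑ m, ∑ p, g.weyl x u y (e m) (e p)
      * (1 / 2 * (g.covSchouten x (f m) (f p) z - g.covSchouten x (f p) (f m) z)))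
    (fun z ↦ .finsetSum fun _ _ ↦ .finsetSum fun _ _ ↦ (g.isLinearMap_weyl₂ x u _ _).mul_const _)
    (fun y ↦ .finsetSum fun _ _ ↦ .finsetSum fun _ _ ↦
      (((l₃ _ _).sub_fun (l₃ _ _)).const_mul _).const_mul _)]
  refine Finset.sum_congr rfl fun a _ ↦ ?_
  rw [h.contract_eq h'
    (B := fun y z ↦ ∑ p, g.weyl x u (e' a) y (e p)
      * (1 / 2 * (g.covSchouten x z (f p) (f' a) - g.covSchouten x (f p) z (f' a))))
    (fun z ↦ .finsetSum fun _ _ ↦ (g.isLinearMap_weyl₃ x u _ _).mul_const _)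
    (fun y ↦ .finsetSum fun _ _ ↦ (((l₁ _ _).sub_fun (l₂ _ _)).const_mul _).const_mul _)]
  refine Finset.sum_congr rfl fun m _ ↦ ?_
  exact h.contract_eq h'
    (B := fun y z ↦ g.weyl x u (e' a) (e' m) y
      * (1 / 2 * (g.covSchouten x (f' m) z (f' a) - g.covSchouten x z (f' m) (f' a))))
    (fun z ↦ (g.isLinearMap_weyl₄ x u _ _).mul_const _)
    (fun y ↦ (((l₂ _ _).sub_fun (l₁ _ _)).const_mul _).const_mul _)

theorem isLinearMap_weylCotton (x : M) (e f : Fin 4 → TangentSpace (𝓡 4) x) :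
    IsLinearMap ℝ (fun u ↦ g.weylCotton x e f u) :=
  .finsetSum fun _ _ ↦ .finsetSum fun _ _ ↦ .finsetSum fun _ _ ↦
    (g.isLinearMap_weyl₁ x _ _ _).mul_const _

-- Frees `Λ` from the preferred coordinates: smoothness is read off in a smooth frame, the conformal
-- law in `up` and `ptl`.
variable {g} in
theorem DualPair.Lam_apply {e f : Fin 4 → TangentSpace (𝓡 4) x} (h : g.DualPair x e f)
    (v : TangentSpace (𝓡 4) x) : g.Lam x v = 8 * g.weylCotton x e f v / g.weylSq x := by
  have hF := ((g.isLinearMap_weylCotton x (g.up x) (ptl x)).const_mul 8).mul_const (g.weylSq x)⁻¹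
  have := (g.dualPair_up_ptl x).sum_mul hF v
  rw [h.weylCotton_eq (g.dualPair_up_ptl x), div_eq_mul_inv, ← this]
  simp only [Lam, _root_.sum_apply, _root_.smul_apply, smul_eq_mul, val_up, weylCotton,
    div_eq_mul_inv]
  exact Finset.sum_congr rfl fun d _ ↦ mul_comm _ _

theorem smoothFun_weylSq (hU : IsOpen U) {x : M} (hUx : U ⊆ dom x) : SmoothFun U g.weylSq := by
  have hl := fun i ↦ (smoothVF_loc x i).mono hUx
  have hc := fun i ↦ (g.smoothVF_coloc x i).mono hUx
  exact (SmoothFun.finsetSum fun d (_ : d ∈ Finset.univ) ↦ .finsetSum fun a (_ : a ∈ Finset.univ) ↦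
    .finsetSum fun m (_ : m ∈ Finset.univ) ↦ .finsetSum fun p (_ : p ∈ Finset.univ) ↦
    (g.smoothFun_weyl hU hUx (hl d) (hl a) (hl m) (hl p)).mul
      (g.smoothFun_weyl hU hUx (hc d) (hc a) (hc m) (hc p))).congr fun _ hy ↦
        (g.dualPair_loc_coloc (hUx hy)).weylSq_eq

theorem smoothFun_Lam (hC : ∀ y, g.weylSq y ≠ 0) (hU : IsOpen U) (hX : SmoothVF U X) :
    SmoothFun U (fun y ↦ g.Lam y (X y)) := by
  intro x hx
  have hV : IsOpen (U ∩ dom x) := hU.inter (isOpen_dom x)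
  have hVx : U ∩ dom x ⊆ dom x := Set.inter_subset_right
  have hl := fun i ↦ (smoothVF_loc x i).mono hVx
  have hc := fun i ↦ (g.smoothVF_coloc x i).mono hVx
  replace hX := hX.mono (V := U ∩ dom x) Set.inter_subset_left
  have hS : SmoothFun (U ∩ dom x) (fun y ↦ 8 * g.weylCotton y (fun i ↦ loc x i y)
      (fun i ↦ g.coloc x i y) (X y) * (g.weylSq y)⁻¹) :=
    ((SmoothFun.const 8).mul (.finsetSum fun a _ ↦ .finsetSum fun m _ ↦ .finsetSum fun p _ ↦
      (g.smoothFun_weyl hV hVx hX (hl a) (hl m) (hl p)).mul ((SmoothFun.const (1 / 2)).mul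
        ((g.smoothFun_covSchouten hV hVx (hc m) (hc p) (hc a)).sub
          (g.smoothFun_covSchouten hV hVx (hc p) (hc m) (hc a)))))).mul
      ((g.smoothFun_weylSq hV hVx).inv fun y _ ↦ hC y)
  have := hS.congr (f₁ := fun y ↦ g.Lam y (X y)) fun y hy ↦ by
    rw [(g.dualPair_loc_coloc (hVx hy)).Lam_apply, div_eq_mul_inv]
  exact (this.contMDiffAt (hV.mem_nhds ⟨hx, mem_dom x⟩)).contMDiffWithinAt

theorem contMDiff_Lam (hC : ∀ y, g.weylSq y ≠ 0) :
    ContMDiff (𝓡 4) ((𝓡 4).prod 𝓘(ℝ, E4 →L[ℝ] ℝ)) ∞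
      (fun x ↦ Bundle.TotalSpace.mk' (E4 →L[ℝ] ℝ)
        (E := fun x ↦ TangentSpace (𝓡 4) x →L[ℝ] ℝ) x (g.Lam x)) := by
  intro x
  refine contMDiffAt_hom_of_extendVec (E₂ := Bundle.Trivial M ℝ) fun v ↦ ?_
  rw [Bundle.contMDiffAt_section]
  exact (g.smoothFun_Lam hC (isOpen_dom x) (smoothVF_extendVec v)).contMDiffAt
    ((isOpen_dom x).mem_nhds (mem_dom x))

theorem smoothVF_sharp_Lam (hC : ∀ y, g.weylSq y ≠ 0) (hU : IsOpen U) :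
    SmoothVF U (fun y ↦ g.sharp y (g.Lam y).toLinearMap) := by
  intro x hx
  have hV : IsOpen (U ∩ dom x) := hU.inter (isOpen_dom x)
  have : SmoothVF (U ∩ dom x) (fun y ↦ g.sharp y (g.Lam y).toLinearMap) := by
    refine g.smoothVF_of_val Set.inter_subset_right fun i ↦ ?_
    simp only [val_sharp]
    exact g.smoothFun_Lam hC hV ((smoothVF_loc x i).mono Set.inter_subset_right)
  exact (this.contMDiffAt (hV.mem_nhds ⟨hx, mem_dom x⟩)).contMDiffWithinAt

theorem transition_apply (x : M) (Y v : TangentSpace (𝓡 4) x) :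
    g.transition x Y v = g.val x Y v • g.sharp x (g.Lam x).toLinearMap - g.Lam x v • Y
      - g.Lam x Y • v := by
  simp [transition]

theorem cConnection_apply (hY : DiffAt Y x) :
    g.cConnection Y x = g.leviCivita Y x + g.transition x (Y x) := by
  classical
  change (if DiffAt Y x then g.leviCivita Y x + g.transition x (Y x) else 0) = _
  rw [if_pos hY]

theorem cConnection_of_not_diffAt (hY : ¬ DiffAt Y x) : g.cConnection Y x = 0 := by
  classical
  change (if DiffAt Y x then g.leviCivita Y x + g.transition x (Y x) else 0) = _
  rw [if_neg hY]

theorem cConnection_apply_apply (hY : DiffAt Y x) (v : TangentSpace (𝓡 4) x) :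
    g.cConnection Y x v = g.leviCivita Y x v + (g.val x (Y x) v • g.sharp x (g.Lam x).toLinearMap
      - g.Lam x v • Y x - g.Lam x (Y x) • v) := by
  rw [g.cConnection_apply hY, _root_.add_apply, transition_apply]

theorem smoothVF_cConnection (hC : ∀ y, g.weylSq y ≠ 0) (hU : IsOpen U) (hX : SmoothVF U X)
    (hY : SmoothVF U Y) : SmoothVF U (fun y ↦ g.cConnection Y y (X y)) := by
  have := (g.smoothVF_nabla hU hX hY).add ((((g.smoothVF_sharp_Lam hC hU).smul
    (g.smoothFun_val hY hX)).sub (hY.smul (g.smoothFun_Lam hC hU hX))).sub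
    (hX.smul (g.smoothFun_Lam hC hU hY)))
  refine this.congr fun y hy ↦ ?_
  exact congrArg _ (g.cConnection_apply_apply (hY.diffAt hU hy) (X y))

theorem isWeylConnection_cConnection (hC : ∀ y, g.weylSq y ≠ 0) :
    g.IsWeylConnection g.cConnection where
  smooth := ⟨⟨fun {Y} hY x _ ↦ by
    have hY' : SmoothVF Set.univ Y := hY.of_le (by simp)
    refine ContMDiffAt.contMDiffWithinAt (contMDiffAt_hom_of_extendVec fun v ↦ ?_)
    exact (g.smoothVF_cConnection hC (isOpen_dom x) (smoothVF_extendVec v)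
      (hY'.mono (Set.subset_univ _))).contMDiffAt ((isOpen_dom x).mem_nhds (mem_dom x))⟩⟩
  torsion_free := by
    rw [CovariantDerivative.torsion_eq_zero_iff]
    intro X Y x hX hY
    -- The transition tensor is symmetric in its lower indices and drops out of the torsion.
    rw [← g.nabla_sub_nabla hX hY, g.cConnection_apply_apply hX, g.cConnection_apply_apply hY,
      g.symm x (Y x)]
    module
  preserves := by
    -- In `-g(Γ_X Y, Z) - g(Y, Γ_X Z)` everything cancels except the two contributions of `-Λ(X) δ`,
    -- whence `η = 2 Λ`.
    refine ⟨fun x ↦ (2 : ℝ) • g.Lam x,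
      ContMDiff.const_smul_section (a := (2 : ℝ)) (g.contMDiff_Lam hC), ?_⟩
    intro x v Y Z hY hZ
    have h := g.leviCivita_metric ((smoothVF_extendVec v).diffAt (isOpen_dom x) (mem_dom x)) hY hZ
    rw [extendVec_self] at h
    rw [h, g.cConnection_apply_apply hY, g.cConnection_apply_apply hZ]
    simp only [map_add, map_sub, map_smul, _root_.add_apply, _root_.sub_apply, _root_.smul_apply,
      smul_eq_mul, val_sharp, g.symm x (Y x) (g.sharp x _), ContinuousLinearMap.coe_coe,
      g.symm x v (Z x)]
    ring

theorem difference_cConnection (x : M) (X Y : TangentSpace (𝓡 4) x) :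
    g.cConnection.difference g.leviCivita x Y X
      = g.val x X Y • g.sharp x (g.Lam x).toLinearMap - g.Lam x X • Y - g.Lam x Y • X := by
  have hY := (smoothVF_extendVec Y).diffAt (isOpen_dom x) (mem_dom x)
  have := IsCovariantDerivativeOn.difference_apply g.cConnection.isCovariantDerivativeOn
    g.leviCivita.isCovariantDerivativeOn (Set.mem_univ x) hY
  rw [extendVec_self] at this
  rw [CovariantDerivative.difference, this, _root_.sub_apply, g.cConnection_apply_apply hY,
    extendVec_self, g.symm x X Y]
  abel

variable {g} {g' : PseudoRiemannianMetric M} {υ : M → ℝ} (hυ : SmoothFun Set.univ υ)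
  (hg : ∀ (x : M) (v w : TangentSpace (𝓡 4) x),
    g'.val x v w = Real.exp (2 * υ x) * g.val x v w)

-- Numerator and denominator both scale by `e^{-4υ}`. The Cotton change adds `½ C_v^{amp} C_{Namp}`
-- to the contraction, equal to `⅛ (C · C) dυ(v)` by the four-dimensional identity, which the factor
-- 8 turns into `dυ(v)`.
include hυ hg in
theorem Lam_conformal (hx : g.weylSq x ≠ 0) (v : TangentSpace (𝓡 4) x) :
    g'.Lam x v = g.Lam x v + g.val x (g.grad υ x) v := by
  have h1 : g'.weylCotton x (g'.up x) (ptl x) v = (Real.exp (2 * υ x))⁻¹ ^ 2 *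
      (g.weylCotton x (g.up x) (ptl x) v
        + 1 / 2 * g.weylContr x (g.up x) (ptl x) v (g.grad υ x)) := by
    simp only [weylCotton, weylContr, weyl_up_conformal hυ hg, cotton_conformal hυ hg,
      Finset.mul_sum, ← Finset.sum_add_distrib]
    refine Finset.sum_congr rfl fun a _ ↦ Finset.sum_congr rfl fun m _ ↦
      Finset.sum_congr rfl fun p _ ↦ ?_
    ring
  have h2 := (g.dualPair_up_ptl x).four_mul_weylContr v (g.grad υ x)
  rw [(g'.dualPair_up_ptl x).Lam_apply, (g.dualPair_up_ptl x).Lam_apply, h1,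
    weylSq_conformal hυ hg, g.symm x _ v]
  field_simp [Real.exp_ne_zero (2 * υ x)]
  linear_combination 2 * h2

include hυ hg in
theorem cConnection_conformal (hC : ∀ x, g.weylSq x ≠ 0) : g'.cConnection = g.cConnection := by
  ext1
  funext Y x
  by_cases hY : DiffAt Y x
  · ext1 v
    -- Raising an index with `g'` costs `e^{-2υ}`, which cancels the factor of `g'` in `g'(X, Y)
    -- Λ'^♯`.
    have hs : g'.sharp x (g'.Lam x).toLinearMap = (Real.exp (2 * υ x))⁻¹ •
        (g.sharp x (g.Lam x).toLinearMap + g.grad υ x) := by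
      refine g'.ext_val fun z ↦ ?_
      rw [val_sharp, hg, map_smul, _root_.smul_apply, map_add, _root_.add_apply, val_sharp,
        smul_eq_mul, mul_inv_cancel_left₀ (Real.exp_ne_zero _)]
      exact Lam_conformal hυ hg (hC x) z
    rw [g'.cConnection_apply_apply hY, g.cConnection_apply_apply hY,
      leviCivita_conformal hυ hg hY, hs, hg, Lam_conformal hυ hg (hC x),
      Lam_conformal hυ hg (hC x), smul_smul, mul_right_comm, mul_inv_cancel₀ (Real.exp_ne_zero _),
      g.symm x v (Y x)]
    module
  -- Equality of bundled connections also concerns fields not differentiable at `x`, where both take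
  -- the default value `0`.
  · rw [g'.cConnection_of_not_diffAt hY, g.cConnection_of_not_diffAt hY]

end PseudoRiemannianMetric

end CConn

end

theorem mainTheorem2 {M : Type*} [TopologicalSpace M] [ChartedSpace CConn.E4 M]
    [IsManifold (𝓡 4) ∞ M] (g g' : CConn.PseudoRiemannianMetric M)
    (Θ : M → ℝ) (hΘ : ContMDiff (𝓡 4) 𝓘(ℝ) ∞ Θ) (hΘ_pos : ∀ x, 0 < Θ x)
    (hg : ∀ (x : M) (v w : TangentSpace (𝓡 4) x), g.val x v w = Θ x ^ 2 * g'.val x v w)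
    (hC : ∀ x, g.weylSq x ≠ 0) :
    g.IsWeylConnection g.cConnection ∧
    (∀ (x : M) (X Y : TangentSpace (𝓡 4) x),
      g.cConnection.difference g.leviCivita x Y X
        = g.val x X Y • g.sharp x (g.Lam x).toLinearMap - g.Lam x X • Y - g.Lam x Y • X) ∧
    g'.cConnection = g.cConnection ∧
    (∀ (x : M) (u v w : TangentSpace (𝓡 4) x),
      CConn.riemann g'.cConnection x u v w = CConn.riemann g.cConnection x u v w) ∧
    (∀ (x : M) (u w : TangentSpace (𝓡 4) x),
      CConn.ricci g'.cConnection x u w = CConn.ricci g.cConnection x u w) := by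
  -- The choice `υ = -log Θ` gives `e^{2υ} = Θ⁻²`; it is smooth because `Θ` is positive.
  have hυ : CConn.SmoothFun Set.univ (fun x ↦ -Real.log (Θ x)) := fun x _ ↦ by
    have h : ContMDiffAt 𝓘(ℝ) 𝓘(ℝ) ∞ (fun t : ℝ ↦ -Real.log t) (Θ x) :=
      (Real.contDiffAt_log.2 (hΘ_pos x).ne').neg.contMDiffAt
    exact (h.comp x (hΘ x)).contMDiffWithinAt
  have hg' : ∀ (x : M) (v w : TangentSpace (𝓡 4) x),
      g'.val x v w = Real.exp (2 * -Real.log (Θ x)) * g.val x v w := fun x v w ↦ by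
    have h : Real.exp (2 * -Real.log (Θ x)) = (Θ x ^ 2)⁻¹ := by
      rw [mul_neg, Real.exp_neg, two_mul, Real.exp_add, Real.exp_log (hΘ_pos x), sq]
    rw [h, hg, inv_mul_cancel_left₀ (pow_pos (hΘ_pos x) 2).ne']
  have h := CConn.PseudoRiemannianMetric.cConnection_conformal hυ hg' hC
  exact ⟨g.isWeylConnection_cConnection hC, g.difference_cConnection, h,
    fun _ _ _ _ ↦ by rw [h], fun _ _ _ ↦ by rw [h]⟩
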